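/- Let $\mathsf{a}\Delta$ be the category with objects $[0+],[0-]$ and $[n]$, $n\ge 1$, with generating morphisms $\alpha_1:[1]\to[0+]$, $\alpha_2:[1]\to[0-]$, $\alpha_i:[n]\to[n-1]$ ($n\ge2$, $1\le i\le 2n$); $\beta_1:[0+]\to[1]$, $\beta_2:[0-]\to[1]$, $\beta_i:[n]\to[n+1]$ ($n\ge1$, $1\le i\le 2n+2$); $\tau:[n]\to[n]$ ($n\ge1$); and $\delta_\pm:[a]\to[a]$ for every object $[a]$; subject to the following relations (whenever the composites are defined): 1. $\alpha_i\alpha_j=\alpha_{j-2}\alpha_i$ on $[n]$ for $i<j-1$, $(i,j)\ne(1,2n)$; 2. $\beta_i\beta_j=\beta_{j+2}\beta_i$ on $[n]$ for $i\le j$, $(i,j)\ne(1,2n+2)$, where $n=0$ for $[0\pm]$; 3. $\tau^n=\mathrm{id}_{[n]}$; 4. $\alpha_i\tau=\tau\alpha_{i-2}$ for $i\ge3$; 5. $\beta_i\tau=\tau\beta_{i-2}$ for $i\ge3$; 6. $\alpha_1\beta_1=\delta_+$ on $[0+]$, $\alpha_2\beta_2=\delta_-$ on $[0-]$, and on $[n]$,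 $n\ge1$: $\alpha_i\beta_i=\delta_+$ for $i$ odd, $\alpha_i\beta_i=\delta_-$ for $i$ even, $\alpha_i\beta_j=\mathrm{id}$ if $|i-j|=1$, $\alpha_1\beta_{2n+2}=\tau^{-1}$, $\alpha_{2n+2}\beta_1=\tau$, $\alpha_i\beta_j=\beta_{j-2}\alpha_i$ if $i<j-1$ and $(i,j)\ne(1,2n+2)$, and $\alpha_i\beta_j=\beta_j\alpha_{i-2}$ if $i>j+1$ and $(i,j)\ne(2n+2,1)$; 7. $\delta_\pm$ commute with all generators. Words are read from right to left, as composites. A word is of Type I if it is a (possibly empty) word in the $\alpha_i$, and of Type III if it is a (possibly empty) word in the $\beta_i$. It is of Type II if it is a power $\tau^s$, $s\ge0$, on $[n]$ with $n\ge 1$, or a (possibly empty) alternating word in $\sigma_+=\alpha_2\beta_1:[0+]\to[0-]$ and $\sigma_-=\alpha_1\beta_2:[0-]\to[0+]$; it is reduced unless it is $\tau^s$ on $[n]$ with $s\ge n$. For a word $w$ of Type III, $w^*$ is the word of Type I obtained by reversing $w$ and replacing each $\beta_i$ by $\alpha_i$. A nonempty word of Type I from $[m]$ to $[n]$ is *irreducible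 of the first kind* if it is $\alpha_{i_k}\cdots\alpha_{i_1}$ with $i_1>\dots>i_k$ and $i_r<2(m-r)+2$ for all $r$. It is *irreducible of the second kind* if it is $\alpha_q\alpha_{i_k}\cdots\alpha_{i_1}\alpha_{j_l}\cdots\alpha_{j_1}$ with $k,l\ge0$, $q=2n+2$ (where $n=0$ for $[0\pm]$), $j_1>\dots>j_l>i_1>\dots>i_k$, $i_r\le2(k-r)+1$ for $1\le r\le k$, and $2(m-l)+1\le j_s\le 2(m-s)+1$ for $1\le s\le l$. A *standard decomposition* of a word $w$ of Type I is a factorization $w=w_r\cdots w_1$, $r\ge0$ (with $r=0$ exactly for the empty word), into irreducible words such that $w_1,\dots,w_{r-1}$ are of the second kind. A *standard form* of a morphism $f$ of $\mathsf{a}\Delta$ consists of $c_+,c_-\ge0$ and words $w_I,w_{II},w_{III}$ of Types I, II, III such that $f=\delta_+^{c_+}\delta_-^{c_-}w_{III}w_{II}w_I$ in $\mathsf{a}\Delta$ and $w_{II}$ is reduced, together with standard decompositions of $w_I$ and of $w_{III}^*$. **Corollary.** Every morphism $f$ of $\mathsf{a}\Delta$ has a unique standard form. Moreover, $f$ can be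 written as $f=\delta_+^{c_+}\delta_-^{c_-}f_{III}f_{II}f_I$ with $c_\pm\ge0$ and $f_I,f_{II},f_{III}$ morphisms of $\mathsf{a}\Delta$ represented by words of Types I, II, III respectively, and the numbers $c_\pm$, the intermediate objects and the morphisms $f_I,f_{II},f_{III}$ are uniquely determined by $f$. -/

import Mathlib

open CategoryTheory

namespace AnnularCat

/-- The objects `[0+]`, `[0-]` and `[n]`, `n ≥ 1`; here `succ n` is the object `[n + 1]`. -/
inductive Obj : Type
  | zeroPlus : Obj
  | zeroMinus : Obj
  | succ (n : ℕ) : Obj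

/-- The number `n` of the object `[n]`, with the convention that `0+` and `0-` count as `0`. -/
def Obj.rank : Obj → ℕ
  | .zeroPlus => 0
  | .zeroMinus => 0
  | .succ n => n + 1

/-- `IsAlpha a i b`: there is a generator `α_i : a → b` (and hence a generator `β_i : b → a`).
These are `α_1 : [1] → [0+]`, `α_2 : [1] → [0-]`, and `α_i : [n] → [n - 1]` for `n ≥ 2` and
`1 ≤ i ≤ 2 n`. -/
inductive IsAlpha : Obj → ℕ → Obj → Prop
  | toPlus : IsAlpha (.succ 0) 1 .zeroPlus
  | toMinus : IsAlpha (.succ 0) 2 .zeroMinus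
  | step (n i : ℕ) (h₁ : 1 ≤ i) (h₂ : i ≤ 2 * (n + 2)) : IsAlpha (.succ (n + 1)) i (.succ n)

/-- The generating morphisms `α_i`, `β_i`, `τ`, `δ_+`, `δ_-`. -/
inductive Gen : Obj → Obj → Type
  | alpha {a b : Obj} (i : ℕ) (h : IsAlpha a i b) : Gen a b
  | beta {a b : Obj} (i : ℕ) (h : IsAlpha a i b) : Gen b a
  | tau (n : ℕ) : Gen (.succ n) (.succ n)
  | deltaPlus (a : Obj) : Gen a a
  | deltaMinus (a : Obj) : Gen a a

instance : Quiver Obj := ⟨Gen⟩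

/-- Words in the generators. The word `h_r ⋯ h_1` (first `h_1`, then `h_2`, …) is the path with
successive edges `h_1, …, h_r`; the empty path at `a` is the identity of `a`. -/
abbrev Word (a b : Obj) : Type := Quiver.Path a b

/-- The word of length one. -/
def Gen.word {a b : Obj} (g : Gen a b) : Word a b := Quiver.Path.nil.cons g

/-- The word `g^s`. -/
def Gen.pow {a : Obj} (g : Gen a a) : ℕ → Word a a
  | 0 => Quiver.Path.nil
  | s + 1 => (g.pow s).cons g

/-- `g ⊚ f` is the word `g f`: first `f`, then `g`. -/
def Word.after {a b c : Obj} (g : Word b c) (f : Word a b) : Word a c := Quiver.Path.comp f g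

infixr:80 " ⊚ " => Word.after

/-- The defining relations of the annular category. -/
inductive Rel : ∀ ⦃a b : Obj⦄, Word a b → Word a b → Prop
  /-- `α_i α_j = α_{j-2} α_i` for `i < j - 1`, `(i, j) ≠ (1, 2n)`, on `[n]`. -/
  | alpha_alpha {a b b' c : Obj} (i j : ℕ) (hij : i + 1 < j) (hne : (i, j) ≠ (1, 2 * a.rank))
      (hj : IsAlpha a j b) (hi : IsAlpha b i c) (hi' : IsAlpha a i b')
      (hj' : IsAlpha b' (j - 2) c) :
      Rel ((Gen.alpha i hi).word ⊚ (Gen.alpha j hj).word)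
        ((Gen.alpha (j - 2) hj').word ⊚ (Gen.alpha i hi').word)
  /-- `β_i β_j = β_{j+2} β_i` for `i ≤ j`, `(i, j) ≠ (1, 2n + 2)`, on `[n]`. -/
  | beta_beta {a b b' c : Obj} (i j : ℕ) (hij : i ≤ j) (hne : (i, j) ≠ (1, 2 * a.rank + 2))
      (hj : IsAlpha b j a) (hi : IsAlpha c i b) (hi' : IsAlpha b' i a)
      (hj' : IsAlpha c (j + 2) b') :
      Rel ((Gen.beta i hi).word ⊚ (Gen.beta j hj).word)
        ((Gen.beta (j + 2) hj').word ⊚ (Gen.beta i hi').word)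
  /-- `τ^n = id` on `[n]`. -/
  | tau_pow (n : ℕ) : Rel ((Gen.tau n).pow (n + 1)) Quiver.Path.nil
  /-- `α_i τ = τ α_{i-2}` for `i ≥ 3`. -/
  | alpha_tau (n m i : ℕ) (hi3 : 3 ≤ i) (hi : IsAlpha (.succ n) i (.succ m))
      (hi' : IsAlpha (.succ n) (i - 2) (.succ m)) :
      Rel ((Gen.alpha i hi).word ⊚ (Gen.tau n).word)
        ((Gen.tau m).word ⊚ (Gen.alpha (i - 2) hi').word)
  /-- `β_i τ = τ β_{i-2}` for `i ≥ 3`. -/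
  | beta_tau (n m i : ℕ) (hi3 : 3 ≤ i) (hi : IsAlpha (.succ m) i (.succ n))
      (hi' : IsAlpha (.succ m) (i - 2) (.succ n)) :
      Rel ((Gen.beta i hi).word ⊚ (Gen.tau n).word)
        ((Gen.tau m).word ⊚ (Gen.beta (i - 2) hi').word)
  /-- `α_i β_i = δ_+` for `i` odd; on `[0+]` this reads `α_1 β_1 = δ_+`. -/
  | alpha_beta_odd {a b : Obj} (i : ℕ) (hodd : Odd i) (hi : IsAlpha b i a) :
      Rel ((Gen.alpha i hi).word ⊚ (Gen.beta i hi).word) (Gen.deltaPlus a).word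
  /-- `α_i β_i = δ_-` for `i` even; on `[0-]` this reads `α_2 β_2 = δ_-`. -/
  | alpha_beta_even {a b : Obj} (i : ℕ) (heven : Even i) (hi : IsAlpha b i a) :
      Rel ((Gen.alpha i hi).word ⊚ (Gen.beta i hi).word) (Gen.deltaMinus a).word
  /-- `α_1 β_{2n+2} = τ^{-1}` on `[n]`, `n ≥ 1`, where `τ^{-1} = τ^{n-1}`. -/
  | alpha_beta_first_last (n : ℕ) {b : Obj} (hi : IsAlpha b 1 (.succ n))
      (hj : IsAlpha b (2 * (n + 1) + 2) (.succ n)) :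
      Rel ((Gen.alpha 1 hi).word ⊚ (Gen.beta (2 * (n + 1) + 2) hj).word) ((Gen.tau n).pow n)
  /-- `α_i β_j = β_{j-2} α_i` on `[n]`, `n ≥ 1`, for `i < j - 1`, `(i, j) ≠ (1, 2n + 2)`. -/
  | alpha_beta_lt (n : ℕ) {b c : Obj} (i j : ℕ) (hij : i + 1 < j)
      (hne : (i, j) ≠ (1, 2 * (n + 1) + 2))
      (hj : IsAlpha b j (.succ n)) (hi : IsAlpha b i (.succ n))
      (hi' : IsAlpha (.succ n) i c) (hj' : IsAlpha (.succ n) (j - 2) c) :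
      Rel ((Gen.alpha i hi).word ⊚ (Gen.beta j hj).word)
        ((Gen.beta (j - 2) hj').word ⊚ (Gen.alpha i hi').word)
  /-- `α_i β_{i+1} = id` on `[n]`, `n ≥ 1`. -/
  | alpha_beta_succ (n : ℕ) {b : Obj} (i : ℕ) (hj : IsAlpha b (i + 1) (.succ n))
      (hi : IsAlpha b i (.succ n)) :
      Rel ((Gen.alpha i hi).word ⊚ (Gen.beta (i + 1) hj).word) Quiver.Path.nil
  /-- `α_{j+1} β_j = id` on `[n]`, `n ≥ 1`. -/
  | alpha_succ_beta (n : ℕ) {b : Obj} (j : ℕ) (hj : IsAlpha b j (.succ n))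
      (hi : IsAlpha b (j + 1) (.succ n)) :
      Rel ((Gen.alpha (j + 1) hi).word ⊚ (Gen.beta j hj).word) Quiver.Path.nil
  /-- `α_i β_j = β_j α_{i-2}` on `[n]`, `n ≥ 1`, for `i > j + 1`, `(i, j) ≠ (2n + 2, 1)`. -/
  | alpha_beta_gt (n : ℕ) {b c : Obj} (i j : ℕ) (hij : j + 1 < i)
      (hne : (i, j) ≠ (2 * (n + 1) + 2, 1))
      (hj : IsAlpha b j (.succ n)) (hi : IsAlpha b i (.succ n))
      (hi' : IsAlpha (.succ n) (i - 2) c) (hj' : IsAlpha (.succ n) j c) :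
      Rel ((Gen.alpha i hi).word ⊚ (Gen.beta j hj).word)
        ((Gen.beta j hj').word ⊚ (Gen.alpha (i - 2) hi').word)
  /-- `α_{2n+2} β_1 = τ` on `[n]`, `n ≥ 1`. -/
  | alpha_beta_last_first (n : ℕ) {b : Obj} (hj : IsAlpha b 1 (.succ n))
      (hi : IsAlpha b (2 * (n + 1) + 2) (.succ n)) :
      Rel ((Gen.alpha (2 * (n + 1) + 2) hi).word ⊚ (Gen.beta 1 hj).word) (Gen.tau n).word
  /-- `δ_+` commutes with all generators. -/
  | deltaPlus_comm {a b : Obj} (g : Gen a b) :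
      Rel ((Gen.deltaPlus b).word ⊚ g.word) (g.word ⊚ (Gen.deltaPlus a).word)
  /-- `δ_-` commutes with all generators. -/
  | deltaMinus_comm {a b : Obj} (g : Gen a b) :
      Rel ((Gen.deltaMinus b).word ⊚ g.word) (g.word ⊚ (Gen.deltaMinus a).word)

/-- The defining relations, as a relation on the morphisms of the free category. -/
def homRel : HomRel (Paths Obj) := fun a b p q => Rel (a := a) (b := b) p q

/-- The annular category: the free category on the generators modulo the defining relations. -/
abbrev ADelta : Type := CategoryTheory.Quotient homRel

/-- The object of the annular category named by `a`. -/
abbrev ADelta.obj (a : Obj) : ADelta := (CategoryTheory.Quotient.functor homRel).obj a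

/-- The morphism of the annular category represented by a word. -/
def Word.eval {a b : Obj} (w : Word a b) : ADelta.obj a ⟶ ADelta.obj b :=
  (CategoryTheory.Quotient.functor homRel).map (X := a) (Y := b) w

/-- Words of Type I: words in the `α_i` (including the identities). In `w.snoc i h` the letter
`α_i` is applied after `w`. -/
inductive AlphaWord : Obj → Obj → Type
  | nil (a : Obj) : AlphaWord a a
  | snoc {a b c : Obj} (w : AlphaWord a b) (i : ℕ) (h : IsAlpha b i c) : AlphaWord a c

namespace AlphaWord

/-- The underlying word. -/
def toWord {a : Obj} : ∀ {b : Obj}, AlphaWord a b → Word a b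
  | _, nil _ => Quiver.Path.nil
  | _, snoc w i h => (Gen.alpha i h).word ⊚ w.toWord

/-- The word `w^*`: reverse the order of the letters and replace each `α_i` by `β_i`. The words of
Type III (words in the `β_i`, including the identities) are the words `w^*`. -/
def star {a : Obj} : ∀ {b : Obj}, AlphaWord a b → Word b a
  | _, nil _ => Quiver.Path.nil
  | _, snoc w i h => w.star ⊚ (Gen.beta i h).word

/-- The list `[i_1, …, i_k]` of the indices of `α_{i_k} ⋯ α_{i_1}`. -/
def indices {a : Obj} : ∀ {b : Obj}, AlphaWord a b → List ℕ
  | _, nil _ => []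
  | _, snoc w i _ => w.indices ++ [i]

/-- `v.after w` is the word `v w`: first `w`, then `v`. -/
def after {a b : Obj} : ∀ {c : Obj}, AlphaWord b c → AlphaWord a b → AlphaWord a c
  | _, nil _, w => w
  | _, snoc v i h, w => snoc (v.after w) i h

/-- Irreducible words of the first kind (ordered words): nonempty words `α_{i_k} ⋯ α_{i_1}` on
`[m]` with `i_1 > ⋯ > i_k` and `i_r < 2(m - r) + 2` for `1 ≤ r ≤ k`. In the code the position
`r : ℕ` starts at `0`. -/
def IsOrdered {a b : Obj} (w : AlphaWord a b) : Prop :=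
  w.indices ≠ [] ∧ w.indices.Pairwise (· > ·) ∧
    ∀ (r : ℕ) (hr : r < w.indices.length),
      w.indices[r] + 2 * (r + 1) < 2 * a.rank + 2

/-- Irreducible words of the second kind: words `α_q α_{i_k} ⋯ α_{i_1} α_{j_l} ⋯ α_{j_1}` from
`[m]` to `[n]` with `k, l ≥ 0`, `q = 2n + 2`, `j_1 > ⋯ > j_l > i_1 > ⋯ > i_k`,
`i_r ≤ 2(k - r) + 1` for `1 ≤ r ≤ k`, and `2(m - l) + 1 ≤ j_s ≤ 2(m - s) + 1` for `1 ≤ s ≤ l`.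
In the code `I = [i_1, …, i_k]`, `J = [j_1, …, j_l]`, and the positions `r s : ℕ` start at `0`. -/
def IsWrapped {a b : Obj} (w : AlphaWord a b) : Prop :=
  ∃ I J : List ℕ, w.indices = J ++ I ++ [2 * b.rank + 2] ∧ (J ++ I).Pairwise (· > ·) ∧
    (∀ (r : ℕ) (hr : r < I.length), I[r] + 2 * (r + 1) ≤ 2 * I.length + 1) ∧
    (∀ (s : ℕ) (hs : s < J.length),
      2 * a.rank + 1 ≤ J[s] + 2 * J.length ∧ J[s] + 2 * (s + 1) ≤ 2 * a.rank + 1)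

end AlphaWord

/-- Standard decompositions `w_r ⋯ w_1` (`r ≥ 0`) of words of Type I: every factor is irreducible,
and every factor except possibly the last one, `w_r`, is of the second kind. The case `r = 0` is
the identity; in `cons w d` the word `w` is `w_1`, applied first. -/
inductive StdDecomp : Obj → Obj → Type
  | nil (a : Obj) : StdDecomp a a
  | single {a b : Obj} (w : AlphaWord a b) (hw : w.IsOrdered) : StdDecomp a b
  | cons {a b c : Obj} (w : AlphaWord a b) (hw : w.IsWrapped) (d : StdDecomp b c) : StdDecomp a c

/-- The word of Type I of which `d` is a standard decomposition. -/
def StdDecomp.toAlphaWord : ∀ {a b : Obj}, StdDecomp a b → AlphaWord a b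
  | _, _, .nil a => .nil a
  | _, _, .single w _ => w
  | _, _, .cons w _ d => d.toAlphaWord.after w

/-- Words of Type II: the powers of `τ` on `[n]`, `n ≥ 1`, and the alternating words in
`σ_+ = α_2 β_1 : [0+] → [0-]` and `σ_- = α_1 β_2 : [0-] → [0+]` (including the identities). -/
inductive RotWord : Obj → Obj → Type
  | tauPow (n s : ℕ) : RotWord (.succ n) (.succ n)
  | idPlus : RotWord .zeroPlus .zeroPlus
  | idMinus : RotWord .zeroMinus .zeroMinus
  | sigmaPlus {a : Obj} (w : RotWord a .zeroPlus) : RotWord a .zeroMinus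
  | sigmaMinus {a : Obj} (w : RotWord a .zeroMinus) : RotWord a .zeroPlus

namespace RotWord

/-- The underlying word. -/
def toWord : ∀ {a b : Obj}, RotWord a b → Word a b
  | _, _, tauPow n s => (Gen.tau n).pow s
  | _, _, idPlus => Quiver.Path.nil
  | _, _, idMinus => Quiver.Path.nil
  | _, _, sigmaPlus w =>
      (Gen.alpha 2 IsAlpha.toMinus).word ⊚ (Gen.beta 1 IsAlpha.toPlus).word ⊚ w.toWord
  | _, _, sigmaMinus w =>
      (Gen.alpha 1 IsAlpha.toPlus).word ⊚ (Gen.beta 2 IsAlpha.toMinus).word ⊚ w.toWord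

/-- A word of Type II is reduced unless it is `τ^s` on `[n]` with `s ≥ n`. -/
def IsReduced : ∀ {a b : Obj}, RotWord a b → Prop
  | _, _, tauPow n s => s < n + 1
  | _, _, _ => True

end RotWord

/-- Standard forms `δ_+^{c_+} δ_-^{c_-} w_III w_II w_I`, where `w_II` is a reduced word of Type II,
and `w_I` and `w_III^*` are words of Type I given with a standard decomposition. -/
structure StandardForm (a b : Obj) where
  cPlus : ℕ
  cMinus : ℕ
  /-- the target of `w_I` -/
  src : Obj
  /-- the source of `w_III` -/
  tgt : Obj
  one : StdDecomp a src
  two : RotWord src tgt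
  two_reduced : two.IsReduced
  /-- the standard decomposition of `w_III^*` -/
  threeStar : StdDecomp b tgt

/-- The word `δ_+^{c_+} δ_-^{c_-} w_III w_II w_I`. -/
def StandardForm.toWord {a b : Obj} (s : StandardForm a b) : Word a b :=
  (Gen.deltaPlus b).pow s.cPlus ⊚ (Gen.deltaMinus b).pow s.cMinus ⊚
    s.threeStar.toAlphaWord.star ⊚ s.two.toWord ⊚ s.one.toAlphaWord.toWord

/-- A morphism is of Type I if it is represented by a word of Type I. -/
def IsTypeI {a b : Obj} (f : ADelta.obj a ⟶ ADelta.obj b) : Prop :=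
  ∃ w : AlphaWord a b, w.toWord.eval = f

/-- A morphism is of Type II if it is represented by a word of Type II. -/
def IsTypeII {a b : Obj} (f : ADelta.obj a ⟶ ADelta.obj b) : Prop :=
  ∃ w : RotWord a b, w.toWord.eval = f

/-- A morphism is of Type III if it is represented by a word of Type III. -/
def IsTypeIII {a b : Obj} (f : ADelta.obj a ⟶ ADelta.obj b) : Prop :=
  ∃ w : AlphaWord b a, w.star.eval = f

/-- Formal composites `δ_+^{c_+} δ_-^{c_-} f_III f_II f_I` of morphisms of Types I, II, III. -/
structure TypeDecomp (a b : Obj) where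
  cPlus : ℕ
  cMinus : ℕ
  /-- the target of `f_I` -/
  src : Obj
  /-- the source of `f_III` -/
  tgt : Obj
  one : ADelta.obj a ⟶ ADelta.obj src
  two : ADelta.obj src ⟶ ADelta.obj tgt
  three : ADelta.obj tgt ⟶ ADelta.obj b
  one_type : IsTypeI one
  two_type : IsTypeII two
  three_type : IsTypeIII three

/-- The morphism `δ_+^{c_+} δ_-^{c_-} f_III f_II f_I`; Mathlib's `f ≫ g` is first `f`, then `g`. -/
def TypeDecomp.eval {a b : Obj} (d : TypeDecomp a b) : ADelta.obj a ⟶ ADelta.obj b :=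
  d.one ≫ d.two ≫ d.three ≫
    Word.eval ((Gen.deltaMinus b).pow d.cMinus) ≫ Word.eval ((Gen.deltaPlus b).pow d.cPlus)

end AnnularCat

/-! Existence is a rewriting argument; uniqueness is read off from a linear representation.

Let `[n]` act on functions of the orientations of `2n` points on a circle (lists of `2n` Booleans).
The operator of `τ` rotates by two places, that of `β_i` inserts a pair of opposite letters at the
cyclic positions `i - 1, i` with weight 2 or 1, and that of `α_i` sums over such insertions. With
scalars depending on the parity of `i`, all relations hold (`Rel.op_eq`, `Word.op_eq_of_eval_eq`),
and `δ_+`, `δ_-` act by 15/2, 5/6. Each letter `σ_±` contributes a factor 2 (`RotWord.op_top`).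

The total orientation is conserved. Hence, if `w_I` ends at an object of rank `t`, a state of total
orientation `2t` passes through the middle only as the all-positive state, and the matrix entries of
a standard form factor as a scalar, times a function of the input determined by `w_I`, times a
function of the output determined by `w_III` (`StandardForm.op_single`). As 2 > 1, each function has
a strict maximum, attained where all caps or cups are positive. So the morphism determines `t` and
these two states (`lower_eq`, `upper_eq`). Such a state, read as a lattice path, determines the
standard decomposition (`StdDecomp.ext_canon`): ordered words give paths that never go below 0, and
a word of the second kind is recovered from the first descent below 0 and the last ascent that is
never undone. With both outer words known, the scalar is known, and 15/2, 5/6, 2 are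
multiplicatively independent (`loop_scalars_injective`). The power of `τ` fixes the all-positive
state, so it is found separately, by cancelling `w_I` and `w_III` and testing on a state with one
negative letter (`rotMor_loopMor_injective`).

For existence, `TypeDecomp.exists_comp_gen` absorbs one more generator into a product of the three
types, and `exists_stdList` rewrites index lists of Type I words into standard ones, one letter at a
time. Every formal composite of the three types comes from a standard form, so uniqueness of
standard forms gives the second assertion too. -/

namespace AnnularCat

/-! ### Insertion of pairs into cyclic lists -/

/-- The inverse of `List.rotate · k`. -/
def unrot (k : ℕ) (x : List Bool) : List Bool := x.rotate (x.length * k - k)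

lemma unrot_rotate (k : ℕ) (x : List Bool) : (unrot k x).rotate k = x := by
  rcases x with _ | ⟨a, x⟩
  · simp [unrot]
  · have h : (a :: x).length * k - k + k = (a :: x).length * k :=
      Nat.sub_add_cancel (Nat.le_mul_of_pos_left k (by simp))
    rw [unrot, List.rotate_rotate, h, List.rotate_length_mul]

lemma length_unrot (k : ℕ) (x : List Bool) : (unrot k x).length = x.length := by
  simp [unrot]

lemma rotate_append_of_length {u v : List Bool} {d : ℕ} (h : u.length = d) :
    (u ++ v).rotate d = v ++ u := by
  subst h; exact List.rotate_append_length_eq u v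

lemma rotate_length_add (x : List Bool) (k : ℕ) : x.rotate (x.length + k) = x.rotate k := by
  rw [← List.rotate_rotate, List.rotate_length]

/-- Insertion of the letters `o, !o` at the cyclic positions `p, p + 1`. -/
def ins (o : Bool) (p : ℕ) (x : List Bool) : List Bool := unrot p (o :: (!o) :: x.rotate p)

lemma ins_rotate (o : Bool) (p : ℕ) (x : List Bool) :
    (ins o p x).rotate p = o :: (!o) :: x.rotate p := unrot_rotate _ _

lemma length_ins (o : Bool) (p : ℕ) (x : List Bool) : (ins o p x).length = x.length + 2 := by
  simp [ins, length_unrot]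

lemma eq_ins {o : Bool} {p : ℕ} {x y : List Bool} (h : y.rotate p = o :: (!o) :: x.rotate p) :
    y = ins o p x :=
  List.rotate_injective p (h.trans (ins_rotate o p x).symm)

lemma ins_inj {o o' : Bool} {p : ℕ} {x x' : List Bool} (h : ins o p x = ins o' p x') :
    o = o' ∧ x = x' := by
  have h' := congrArg (fun y => y.rotate p) h
  simp only [ins_rotate, List.cons.injEq] at h'
  exact ⟨h'.1, List.rotate_injective p h'.2.2⟩

lemma ins_rotate_add (o : Bool) (p d : ℕ) (x : List Bool) (h : d ≤ x.length) :
    (ins o p x).rotate (p + (d + 2)) =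
      (x.rotate p).drop d ++ [o, !o] ++ (x.rotate p).take d := by
  rw [← List.rotate_rotate, ins_rotate, List.rotate_eq_drop_append_take (by simp; omega)]
  simp

/-- The bounds say that the pair at `q` does not meet the pair at `p` on the circle of length
`w.length + 4`, so the order of insertion only shifts an index by 2. -/
lemma ins_ins (o o' : Bool) {p q : ℕ} {w : List Bool} (h₁ : p + 2 ≤ q) (h₂ : q ≤ p + 2 + w.length) :
    ins o' q (ins o p w) = ins o p (ins o' (q - 2) w) := by
  obtain ⟨d, rfl⟩ := Nat.exists_eq_add_of_le h₁
  have hd : d ≤ w.length := by omega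
  have e : p + 2 + d = p + (d + 2) := by ring
  have e' : p + 2 + d - 2 = p + d := by omega
  refine (eq_ins ?_).symm
  rw [e', e, ins_rotate_add o p d w hd, ins_rotate_add o p d _ (by rw [length_ins]; omega)]
  have hv : (ins o' (p + d) w).rotate p =
      (w.rotate p).take d ++ ([o', !o'] ++ (w.rotate p).drop d) := by
    have hl : ((w.rotate p).take d).length = d := by simpa using hd
    apply List.rotate_injective d
    change ((ins o' (p + d) w).rotate p).rotate d = List.rotate _ d
    rw [List.rotate_rotate, ins_rotate, ← List.rotate_rotate,
      List.rotate_eq_drop_append_take (by simpa using hd), rotate_append_of_length hl]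
    simp
  have hl : ((w.rotate p).take d).length = d := by simpa using hd
  rw [hv, List.drop_left' hl, List.take_left' hl]
  simp

/-- The bounds keep the two pairs disjoint on the circle, so the letters of the second pair are
already adjacent in `x`; removing both pairs gives `w`. -/
lemma exists_of_ins_eq_ins {o o' : Bool} {p q : ℕ} {x z : List Bool} (h₁ : p + 2 ≤ q)
    (h₂ : q ≤ p + x.length) (h : ins o p x = ins o' q z) :
    ∃ w, x = ins o' (q - 2) w ∧ z = ins o p w := by
  obtain ⟨d, rfl⟩ := Nat.exists_eq_add_of_le h₁
  have hd : d + 2 ≤ x.length := by omega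
  have e : p + 2 + d = p + (d + 2) := by ring
  have e' : p + 2 + d - 2 = p + d := by omega
  have hy := congrArg (fun y => y.rotate (p + 2 + d)) h
  simp only [ins_rotate] at hy
  rw [e, ins_rotate_add o p d x (by omega)] at hy
  have hlen : ((x.rotate p).drop d).length = x.length - d := by simp
  obtain ⟨b, c, v, hv⟩ : ∃ b c v, (x.rotate p).drop d = b :: c :: v := by
    rcases hx : (x.rotate p).drop d with _ | ⟨b, _ | ⟨c, v⟩⟩
    · simp [hx] at hlen; omega
    · simp [hx] at hlen; omega
    · exact ⟨b, c, v, rfl⟩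
  rw [hv] at hy
  simp only [List.cons_append, List.cons.injEq] at hy
  obtain ⟨rfl, rfl, -⟩ := hy
  have hu : ((x.rotate p).take d).length = d := by simp; omega
  have hx : x = ins b (p + d) (unrot p ((x.rotate p).take d ++ v)) := by
    refine eq_ins ?_
    rw [← List.rotate_rotate, ← List.rotate_rotate, unrot_rotate,
      List.rotate_eq_drop_append_take (by simp; omega), hv]
    rw [rotate_append_of_length hu]
    simp
  rw [e']
  refine ⟨_, hx, ?_⟩
  have hlw := congrArg List.length hx
  rw [length_ins] at hlw
  have := ins_ins o b (p := p) (q := p + 2 + d) (w := unrot p ((x.rotate p).take d ++ v)) h₁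
    (by omega)
  rw [e', ← hx, h] at this
  exact (ins_inj this).2.symm

/-! ### Cap and cup operators and their relations -/

/-- The weight of an inserted pair. -/
def wt (o : Bool) : ℚ := if o then 2 else 1

/-- The operator of a cap at the cyclic positions `p, p + 1`, up to a scalar. -/
def capOp (p : ℕ) : (List Bool → ℚ) →ₗ[ℚ] (List Bool → ℚ) where
  toFun φ x := wt true / 2 * φ (ins true p x) + wt false / 2 * φ (ins false p x)
  map_add' φ ψ := by ext x; simp; ring
  map_smul' c φ := by ext x; simp; ring

/-- The operator of a cup at the cyclic positions `p, p + 1`, up to a scalar. -/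
def cupOp (p : ℕ) : (List Bool → ℚ) →ₗ[ℚ] (List Bool → ℚ) where
  toFun φ y := match y.rotate p with
    | a :: b :: r => if b = !a then wt a * φ (unrot p r) else 0
    | _ => 0
  map_add' φ ψ := by
    ext y
    simp only [Pi.add_apply]
    rcases y.rotate p with _ | ⟨a, _ | ⟨b, r⟩⟩ <;> simp only [add_zero]
    split_ifs <;> ring
  map_smul' c φ := by
    ext y
    simp only [Pi.smul_apply, smul_eq_mul, RingHom.id_apply]
    rcases y.rotate p with _ | ⟨a, _ | ⟨b, r⟩⟩ <;> simp only [mul_zero]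
    split_ifs <;> ring

lemma capOp_apply (p : ℕ) (φ : List Bool → ℚ) (x : List Bool) :
    capOp p φ x = wt true / 2 * φ (ins true p x) + wt false / 2 * φ (ins false p x) := rfl

lemma cupOp_ins (p : ℕ) (φ : List Bool → ℚ) (o : Bool) (x : List Bool) :
    cupOp p φ (ins o p x) = wt o * φ x := by
  simp only [cupOp, LinearMap.coe_mk, AddHom.coe_mk, ins_rotate, if_true]
  congr 2
  exact List.rotate_injective p (unrot_rotate p _)

lemma cupOp_eq_zero (p : ℕ) (φ : List Bool → ℚ) {y : List Bool} (h : ∀ o x, y ≠ ins o p x) :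
    cupOp p φ y = 0 := by
  simp only [cupOp, LinearMap.coe_mk, AddHom.coe_mk]
  rcases hy : y.rotate p with _ | ⟨a, _ | ⟨b, r⟩⟩
  · rfl
  · rfl
  · simp only [ite_eq_right_iff]
    rintro rfl
    exact absurd (eq_ins (by rw [hy, unrot_rotate])) (h a (unrot p r))

lemma capOp_capOp {p q : ℕ} (φ : List Bool → ℚ) {x : List Bool} (h₁ : p + 2 ≤ q)
    (h₂ : q ≤ p + 2 + x.length) :
    capOp p (capOp q φ) x = capOp (q - 2) (capOp p φ) x := by
  simp only [capOp_apply, ins_ins _ _ h₁ h₂]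
  ring

/-- Both sides vanish unless `y` contains both disjoint pairs, and then `ins_ins` applies. The same
dichotomy proves the two commutations of caps with cups below. -/
lemma cupOp_cupOp {p q : ℕ} (φ : List Bool → ℚ) {y : List Bool} (h₁ : p ≤ q)
    (h₂ : q + 4 ≤ p + y.length) :
    cupOp p (cupOp q φ) y = cupOp (q + 2) (cupOp p φ) y := by
  by_cases hy : ∃ o x, y = ins o p x
  · obtain ⟨o, x, rfl⟩ := hy
    rw [length_ins] at h₂
    rw [cupOp_ins]
    by_cases hx : ∃ o' w, x = ins o' q w
    · obtain ⟨o', w, rfl⟩ := hx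
      rw [length_ins] at h₂
      have := ins_ins o o' (p := p) (q := q + 2) (w := w) (by omega) (by omega)
      rw [Nat.add_sub_cancel] at this
      rw [← this, cupOp_ins, cupOp_ins, cupOp_ins]
      ring
    · push Not at hx
      rw [cupOp_eq_zero q φ hx, mul_zero]
      symm
      apply cupOp_eq_zero
      intro o' z hz
      obtain ⟨w, hw, -⟩ := exists_of_ins_eq_ins (by omega) (by omega) hz
      exact hx o' w hw
  · push Not at hy
    rw [cupOp_eq_zero p _ hy]
    by_cases hz : ∃ o' z, y = ins o' (q + 2) z
    · obtain ⟨o', z, rfl⟩ := hz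
      rw [length_ins] at h₂
      rw [cupOp_ins, cupOp_eq_zero p φ, mul_zero]
      rintro o w rfl
      rw [length_ins] at h₂
      exact hy o _ (ins_ins o o' (by omega) (by omega))
    · push Not at hz
      rw [cupOp_eq_zero _ _ hz]

lemma capOp_cupOp_of_lt {p q : ℕ} (φ : List Bool → ℚ) {x : List Bool} (h₁ : p + 2 ≤ q)
    (h₂ : q ≤ p + x.length) :
    capOp p (cupOp q φ) x = cupOp (q - 2) (capOp p φ) x := by
  by_cases hx : ∃ o' w, x = ins o' (q - 2) w
  · obtain ⟨o', w, rfl⟩ := hx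
    rw [length_ins] at h₂
    rw [cupOp_ins]
    simp only [capOp_apply, ← ins_ins _ _ h₁ (show q ≤ p + 2 + w.length by omega), cupOp_ins]
    ring
  · push Not at hx
    have h : ∀ o, cupOp q φ (ins o p x) = 0 := by
      intro o
      apply cupOp_eq_zero
      intro o' z hz
      obtain ⟨w, hw, -⟩ := exists_of_ins_eq_ins h₁ h₂ hz
      exact hx o' w hw
    rw [cupOp_eq_zero _ _ hx, capOp_apply, h, h]
    ring

lemma capOp_cupOp_of_gt {p q : ℕ} (φ : List Bool → ℚ) {x : List Bool} (h₁ : q + 2 ≤ p)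
    (h₂ : p ≤ q + x.length) :
    capOp p (cupOp q φ) x = cupOp q (capOp (p - 2) φ) x := by
  by_cases hx : ∃ o' w, x = ins o' q w
  · obtain ⟨o', w, rfl⟩ := hx
    rw [length_ins] at h₂
    rw [cupOp_ins]
    simp only [capOp_apply, ins_ins _ _ h₁ (show p ≤ q + 2 + w.length by omega), cupOp_ins]
    ring
  · push Not at hx
    have h : ∀ o, cupOp q φ (ins o p x) = 0 := by
      intro o
      apply cupOp_eq_zero
      intro o' z hz
      have hl := congrArg List.length hz
      rw [length_ins, length_ins] at hl
      obtain ⟨w, -, hw⟩ := exists_of_ins_eq_ins h₁ (by omega) hz.symm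
      exact hx o' w hw
    rw [cupOp_eq_zero _ _ hx, capOp_apply, h, h]
    ring

/-- Both orientations of the loop contribute, giving (2² + 1²)/2. -/
lemma capOp_cupOp_self (p : ℕ) (φ : List Bool → ℚ) (x : List Bool) :
    capOp p (cupOp p φ) x = 5 / 2 * φ x := by
  simp only [capOp_apply, cupOp_ins]
  simp [wt]
  ring

/-- If exactly one of the two insertions of a cap meets a cup, the composite is a substitution. -/
lemma capOp_cupOp_of_unique {p q : ℕ} (φ : List Bool → ℚ) {x z : List Bool} (a : Bool)
    (h : ins (!a) p x = ins a q z) (h' : ∀ o z, ins a p x ≠ ins o q z) :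
    capOp p (cupOp q φ) x = φ z := by
  have h₁ := cupOp_ins q φ a z
  have h₂ := cupOp_eq_zero q φ h'
  rw [← h] at h₁
  -- The cap and the cup see opposite orientations, so the factor is 2 · 1 / 2 = 1; this is why the
  -- cap carries the factor 1/2.
  cases a
  · simp only [capOp_apply, h₂]
    simp only [Bool.not_false] at h₁
    simp [h₁, wt]
  · simp only [capOp_apply, h₂]
    simp only [Bool.not_true] at h₁
    simp [h₁, wt]

/-- The cap and the cup share one place. The letter `a` of `x` next to it forces the orientation of
the cap, so just one of the two insertions survives. The next three lemmas rest on the same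
observation. -/
lemma capOp_cupOp_succ (p : ℕ) (φ : List Bool → ℚ) {x : List Bool} (hx : x ≠ []) :
    capOp p (cupOp (p + 1) φ) x = φ x := by
  obtain ⟨a, r, hr⟩ : ∃ a r, x.rotate p = a :: r := by
    rcases h : x.rotate p with _ | ⟨a, r⟩
    · simp at h; exact absurd h hx
    · exact ⟨a, r, rfl⟩
  have hxr : x.rotate (p + 1) = r ++ [a] := by rw [← List.rotate_rotate, hr]; simp
  have key : ∀ o, (ins o p x).rotate (p + 1) = (!o) :: a :: (r ++ [o]) := by
    intro o; rw [← List.rotate_rotate, ins_rotate, hr]; simp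
  apply capOp_cupOp_of_unique φ (!a)
  · apply eq_ins
    rw [key, hxr]; simp
  · intro o z h
    have := key (!a)
    rw [h, ins_rotate] at this
    simp only [List.cons.injEq] at this
    revert this
    cases a <;> cases o <;> simp

lemma capOp_succ_cupOp (p : ℕ) (φ : List Bool → ℚ) {x : List Bool} (hx : x ≠ []) :
    capOp (p + 1) (cupOp p φ) x = φ x := by
  obtain ⟨a, r, hr⟩ : ∃ a r, x.rotate p = a :: r := by
    rcases h : x.rotate p with _ | ⟨a, r⟩
    · simp at h; exact absurd h hx
    · exact ⟨a, r, rfl⟩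
  have hxr : x.rotate (p + 1) = r ++ [a] := by rw [← List.rotate_rotate, hr]; simp
  have key : ∀ o, (ins o (p + 1) x).rotate p = a :: o :: (!o) :: r := by
    intro o
    apply List.rotate_injective 1
    change ((ins o (p + 1) x).rotate p).rotate 1 = _
    rw [List.rotate_rotate, ins_rotate, hxr]; simp
  apply capOp_cupOp_of_unique φ a
  · apply eq_ins
    rw [key, hr]; simp
  · intro o z h
    have := key a
    rw [h, ins_rotate] at this
    simp only [List.cons.injEq] at this
    revert this
    cases a <;> cases o <;> simp

/-- Straightening the strand around the cut moves every letter by two places: this is the rotation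
by `-2`. For `x.length = 1` the truncated subtraction is harmless, since rotating a singleton does
nothing. -/
lemma capOp_zero_cupOp_last (φ : List Bool → ℚ) {x : List Bool} (hx : x ≠ []) :
    capOp 0 (cupOp (x.length + 1) φ) x = φ (x.rotate (x.length - 2 + x.length)) := by
  obtain ⟨r, a, rfl⟩ : ∃ r a, x = r ++ [a] := ⟨_, _, (List.dropLast_append_getLast hx).symm⟩
  have hl : (r ++ [a]).length = r.length + 1 := by simp
  have h0 : ∀ o, ins o 0 (r ++ [a]) = o :: (!o) :: (r ++ [a]) := by
    intro o; have := ins_rotate o 0 (r ++ [a]); simpa using this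
  have key : ∀ o, (ins o 0 (r ++ [a])).rotate (r.length + 1 + 1) = a :: o :: (!o) :: r := by
    intro o
    rw [h0, show o :: (!o) :: (r ++ [a]) = (o :: (!o) :: r) ++ [a] by simp]
    simp
  have hrot : ((r ++ [a]).rotate ((r ++ [a]).length - 2 + (r ++ [a]).length)).rotate
      (r.length + 1 + 1) = a :: r := by
    rw [List.rotate_rotate, hl]
    rcases r with _ | ⟨b, r⟩
    · simp
    · have e : (b :: r).length + 1 - 2 + ((b :: r).length + 1) + ((b :: r).length + 1 + 1) =
          (b :: r ++ [a]).length + ((b :: r ++ [a]).length + (b :: r).length) := by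
        simp; omega
      rw [e, rotate_length_add]
      rw [rotate_length_add, List.rotate_append_length_eq]; simp
  rw [hl] at hrot ⊢
  apply capOp_cupOp_of_unique φ a
  · apply eq_ins
    rw [key, hrot]; simp
  · intro o z h
    have := key a
    rw [h, ins_rotate] at this
    simp only [List.cons.injEq] at this
    revert this
    cases a <;> cases o <;> simp

lemma capOp_last_cupOp_zero (φ : List Bool → ℚ) {x : List Bool} (hx : x ≠ []) :
    capOp (x.length + 1) (cupOp 0 φ) x = φ (x.rotate 2) := by
  obtain ⟨a, r, hr⟩ : ∃ a r, x.rotate 1 = a :: r := by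
    rcases h : x.rotate 1 with _ | ⟨a, r⟩
    · simp at h; exact absurd h hx
    · exact ⟨a, r, rfl⟩
  have hlr : x.length = r.length + 1 := by simpa using congrArg List.length hr
  have hxr : x.rotate 2 = r ++ [a] := by
    rw [show 2 = 1 + 1 from rfl, ← List.rotate_rotate, hr]; simp
  have key : ∀ o, ins o (x.length + 1) x = (!o) :: a :: (r ++ [o]) := by
    intro o
    apply List.rotate_injective (x.length + 1)
    change (ins o (x.length + 1) x).rotate _ = _
    rw [ins_rotate, rotate_length_add, hr]
    rw [show (!o) :: a :: (r ++ [o]) = ((!o) :: a :: r) ++ [o] by simp, hlr]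
    simp
  apply capOp_cupOp_of_unique φ (!a)
  · apply eq_ins
    rw [key, hxr]; simp
  · intro o z h
    have h2 := ins_rotate o 0 z
    rw [← h, key] at h2
    simp only [List.rotate_zero, List.cons.injEq] at h2
    revert h2
    cases a <;> cases o <;> simp

/-! ### The representation of the annular category -/

lemma IsAlpha.one_le {a b : Obj} {i : ℕ} (h : IsAlpha a i b) : 1 ≤ i := by
  cases h <;> omega

lemma IsAlpha.le {a b : Obj} {i : ℕ} (h : IsAlpha a i b) : i ≤ 2 * a.rank := by
  cases h <;> simp only [Obj.rank] <;> omega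

lemma IsAlpha.rank_eq {a b : Obj} {i : ℕ} (h : IsAlpha a i b) : a.rank = b.rank + 1 := by
  cases h <;> simp [Obj.rank]

/-- The scalar of the operator of `α_i`. -/
def capScale (i : ℕ) : ℚ := if Odd i then 3 else 1

/-- The scalar of the operator of `β_i`. -/
def cupScale (i : ℕ) : ℚ := if Odd i then 1 else 1 / 3

lemma capScale_pos (i : ℕ) : 0 < capScale i := by unfold capScale; split_ifs <;> norm_num
lemma cupScale_pos (i : ℕ) : 0 < cupScale i := by unfold cupScale; split_ifs <;> norm_num

/-- In a zigzag the indices have different parity and the scalars cancel; in a loop they agree and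
give 3 or 1/3. This separates `δ_+` from `δ_-` without disturbing the other relations. -/
lemma capScale_mul_cupScale_succ (i : ℕ) : capScale i * cupScale (i + 1) = 1 := by
  unfold capScale cupScale
  by_cases h : Odd i <;> simp [h, Nat.odd_add_one]

lemma capScale_succ_mul_cupScale (i : ℕ) : capScale (i + 1) * cupScale i = 1 := by
  unfold capScale cupScale
  by_cases h : Odd i <;> simp [h, Nat.odd_add_one]

lemma capScale_sub_two {i : ℕ} (h : 2 ≤ i) : capScale (i - 2) = capScale i := by
  obtain ⟨j, rfl⟩ := Nat.exists_eq_add_of_le' h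
  simp [capScale, Nat.odd_add]

lemma cupScale_sub_two {i : ℕ} (h : 2 ≤ i) : cupScale (i - 2) = cupScale i := by
  obtain ⟨j, rfl⟩ := Nat.exists_eq_add_of_le' h
  simp [cupScale, Nat.odd_add]

/-- The operator of `τ`. -/
def rotOp : (List Bool → ℚ) →ₗ[ℚ] (List Bool → ℚ) where
  toFun φ x := φ (x.rotate 2)
  map_add' _ _ := rfl
  map_smul' _ _ := rfl

lemma rotOp_apply (φ : List Bool → ℚ) (x : List Bool) : rotOp φ x = φ (x.rotate 2) := rfl

/-- The operator of a generator. -/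
def Gen.op {a b : Obj} : Gen a b → ((List Bool → ℚ) →ₗ[ℚ] (List Bool → ℚ))
  | .alpha i _ => capScale i • capOp (i - 1)
  | .beta i _ => cupScale i • cupOp (i - 1)
  | .tau _ => rotOp
  | .deltaPlus _ => (15 / 2 : ℚ) • LinearMap.id
  | .deltaMinus _ => (5 / 6 : ℚ) • LinearMap.id

/-- The operator of a word. -/
def Word.op {a : Obj} : ∀ {b : Obj}, Word a b → ((List Bool → ℚ) →ₗ[ℚ] (List Bool → ℚ))
  | _, .nil => LinearMap.id
  | _, .cons w g => Gen.op g ∘ₗ Word.op w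

lemma Word.op_comp {a b : Obj} (w : Word a b) :
    ∀ {c : Obj} (v : Word b c), Word.op (Quiver.Path.comp w v) = v.op ∘ₗ w.op
  | _, .nil => rfl
  | _, .cons v g => by
    rw [Quiver.Path.comp_cons, Word.op, Word.op_comp w v, Word.op, LinearMap.comp_assoc]

lemma Word.op_after {a b c : Obj} (v : Word b c) (w : Word a b) : (v ⊚ w).op = v.op ∘ₗ w.op :=
  Word.op_comp w v

lemma Gen.op_word {a b : Obj} (g : Gen a b) : g.word.op = g.op := rfl

lemma Gen.op_pow {a : Obj} (g : Gen a a) : ∀ s, (g.pow s).op = g.op ^ s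
  | 0 => rfl
  | s + 1 => by
    rw [Gen.pow, Word.op, Gen.op_pow g s, pow_succ']
    rfl

lemma rotOp_pow_apply (φ : List Bool → ℚ) :
    ∀ (s : ℕ) (x : List Bool), (rotOp ^ s) φ x = φ (x.rotate (2 * s))
  | 0, x => by simp
  | s + 1, x => by
    rw [pow_succ', Module.End.mul_apply, rotOp_apply, rotOp_pow_apply φ s, List.rotate_rotate]
    congr 2
    ring

/-- The operator of a generator is determined on the states of its target by the values on the
states of its source. -/
lemma Gen.op_congr {a b : Obj} (g : Gen a b) {φ ψ : List Bool → ℚ}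
    (h : ∀ x, x.length = 2 * a.rank → φ x = ψ x) {y : List Bool} (hy : y.length = 2 * b.rank) :
    g.op φ y = g.op ψ y := by
  cases g with
  | alpha i hi =>
    have := hi.rank_eq
    simp only [Gen.op, LinearMap.smul_apply, Pi.smul_apply, capOp_apply]
    rw [h _ (by rw [length_ins]; omega), h _ (by rw [length_ins]; omega)]
  | beta i hi =>
    have := hi.rank_eq
    simp only [Gen.op, LinearMap.smul_apply, Pi.smul_apply]
    by_cases hx : ∃ o x, y = ins o (i - 1) x
    · obtain ⟨o, x, rfl⟩ := hx
      rw [length_ins] at hy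
      rw [cupOp_ins, cupOp_ins, h _ (by omega)]
    · push Not at hx
      rw [cupOp_eq_zero _ _ hx, cupOp_eq_zero _ _ hx]
  | tau n => exact h _ (by simpa using hy)
  | deltaPlus => simp [Gen.op, h y hy]
  | deltaMinus => simp [Gen.op, h y hy]

lemma Word.op_congr {a : Obj} : ∀ {b : Obj} (w : Word a b) {φ ψ : List Bool → ℚ}
    (_ : ∀ x, x.length = 2 * a.rank → φ x = ψ x) {y : List Bool} (_ : y.length = 2 * b.rank),
    w.op φ y = w.op ψ y
  | _, .nil, _, _, h, _, hy => h _ hy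
  | _, .cons w g, _, _, h, _, hy =>
    Gen.op_congr g (fun _ hx => Word.op_congr w h hx) hy

lemma ins_rotate_two (o : Bool) {p : ℕ} (hp : 2 ≤ p) (x : List Bool) :
    (ins o p x).rotate 2 = ins o (p - 2) (x.rotate 2) := by
  apply eq_ins
  rw [List.rotate_rotate, List.rotate_rotate, show 2 + (p - 2) = p by omega, ins_rotate]

lemma capOp_rotOp {p : ℕ} (hp : 2 ≤ p) (φ : List Bool → ℚ) :
    capOp p (rotOp φ) = rotOp (capOp (p - 2) φ) := by
  ext x
  simp only [capOp_apply, rotOp_apply, ins_rotate_two _ hp]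

lemma cupOp_rotOp {p : ℕ} (hp : 2 ≤ p) (φ : List Bool → ℚ) :
    cupOp p (rotOp φ) = rotOp (cupOp (p - 2) φ) := by
  ext y
  rw [rotOp_apply]
  by_cases hy : ∃ o x, y = ins o p x
  · obtain ⟨o, x, rfl⟩ := hy
    rw [cupOp_ins, ins_rotate_two _ hp, cupOp_ins, rotOp_apply]
  · push Not at hy
    rw [cupOp_eq_zero _ _ hy, cupOp_eq_zero]
    intro o z hz
    apply hy o (unrot 2 z)
    apply List.rotate_injective 2
    change y.rotate 2 = (ins _ _ _).rotate 2
    rw [ins_rotate_two _ hp, unrot_rotate, hz]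

/-- The operators act on functions of lists of any length, but the relations that involve the length
of the circle, such as `τ^n = id`, hold only on lists of the length belonging to the object. -/
lemma Rel.op_eq {a b : Obj} {v w : Word a b} (h : Rel v w) (φ : List Bool → ℚ) {x : List Bool}
    (hx : x.length = 2 * b.rank) : v.op φ x = w.op φ x := by
  cases h with
  | alpha_alpha i j hij hne hj hi hi' hj' =>
    have := hj.rank_eq; have := hi.rank_eq; have := hj.le; have := hi.one_le
    have hne' : i = 1 → j ≠ 2 * a.rank := fun h h' => hne (by rw [h, h'])
    simp only [Word.op_after, Gen.op_word, Gen.op, LinearMap.comp_apply, LinearMap.smul_apply,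
      map_smul, Pi.smul_apply, smul_eq_mul]
    rw [capOp_capOp φ (by omega) (by omega), capScale_sub_two (by omega),
      show j - 1 - 2 = j - 2 - 1 by omega]
    ring
  | beta_beta i j hij hne hj hi hi' hj' =>
    have := hj.rank_eq; have := hi.rank_eq; have := hj.le; have := hi.one_le
    have hne' : i = 1 → j ≠ 2 * a.rank + 2 := fun h h' => hne (by rw [h, h'])
    simp only [Word.op_after, Gen.op_word, Gen.op, LinearMap.comp_apply, LinearMap.smul_apply,
      map_smul, Pi.smul_apply, smul_eq_mul]
    rw [cupOp_cupOp φ (by omega) (by omega), ← cupScale_sub_two (i := j + 2) (by omega),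
      show j + 2 - 1 = j - 1 + 2 by omega]
    simp only [Nat.add_sub_cancel]
    ring
  | tau_pow n =>
    rw [Gen.op_pow, Gen.op, rotOp_pow_apply]
    simp only [Obj.rank] at hx
    rw [← hx, List.rotate_length]
    rfl
  | alpha_tau n m i hi3 hi hi' =>
    simp only [Word.op_after, Gen.op_word, Gen.op, LinearMap.comp_apply, LinearMap.smul_apply,
      map_smul]
    rw [capOp_rotOp (by omega), capScale_sub_two (by omega), show i - 1 - 2 = i - 2 - 1 by omega]
  | beta_tau n m i hi3 hi hi' =>
    simp only [Word.op_after, Gen.op_word, Gen.op, LinearMap.comp_apply, LinearMap.smul_apply,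
      map_smul]
    rw [cupOp_rotOp (by omega), cupScale_sub_two (by omega), show i - 1 - 2 = i - 2 - 1 by omega]
  | alpha_beta_odd i hodd hi =>
    simp only [Word.op_after, Gen.op_word, Gen.op, LinearMap.comp_apply, LinearMap.smul_apply,
      map_smul, Pi.smul_apply, smul_eq_mul, capOp_cupOp_self, LinearMap.id_apply]
    simp only [capScale, cupScale, hodd, if_true]
    ring
  | alpha_beta_even i heven hi =>
    have hodd : ¬ Odd i := Nat.not_odd_iff_even.2 heven
    simp only [Word.op_after, Gen.op_word, Gen.op, LinearMap.comp_apply, LinearMap.smul_apply,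
      map_smul, Pi.smul_apply, smul_eq_mul, capOp_cupOp_self, LinearMap.id_apply]
    simp only [capScale, cupScale, hodd, if_false]
    ring
  | alpha_beta_first_last n hi hj =>
    simp only [Obj.rank] at hx
    simp only [Word.op_after, Gen.op_word, Gen.op_pow, Gen.op, LinearMap.comp_apply,
      LinearMap.smul_apply, map_smul, Pi.smul_apply, smul_eq_mul, rotOp_pow_apply]
    rw [show 2 * (n + 1) + 2 - 1 = x.length + 1 by omega,
      capOp_zero_cupOp_last _ (by rintro rfl; simp at hx)]
    have : ¬ Odd (2 * (n + 1) + 2) := Nat.not_odd_iff_even.2 ⟨n + 2, by ring⟩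
    simp only [capScale, cupScale, this, if_false, odd_one, if_true]
    rw [add_comm, rotate_length_add, show 2 * n = x.length - 2 by omega]
    ring
  | alpha_beta_lt n i j hij hne hj hi hi' hj' =>
    have := hi'.rank_eq; have := hj.rank_eq; have := hj.le; have := hi.one_le
    simp only [Obj.rank] at *
    have hne' : i = 1 → j ≠ 2 * (n + 1) + 2 := fun h h' => hne (by rw [h, h'])
    simp only [Word.op_after, Gen.op_word, Gen.op, LinearMap.comp_apply, LinearMap.smul_apply,
      map_smul, Pi.smul_apply, smul_eq_mul]
    rw [capOp_cupOp_of_lt φ (by omega) (by omega), cupScale_sub_two (by omega),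
      show j - 1 - 2 = j - 2 - 1 by omega]
    ring
  | alpha_beta_succ n i hj hi =>
    simp only [Obj.rank] at hx
    have := hi.one_le
    simp only [Word.op_after, Gen.op_word, Gen.op, LinearMap.comp_apply, LinearMap.smul_apply,
      map_smul, Pi.smul_apply, smul_eq_mul, ← mul_assoc]
    rw [show i + 1 - 1 = i - 1 + 1 by omega, capOp_cupOp_succ _ _ (by rintro rfl; simp at hx),
      mul_comm (cupScale _), capScale_mul_cupScale_succ]
    simp [Word.op]
  | alpha_succ_beta n j hj hi =>
    simp only [Obj.rank] at hx
    have := hj.one_le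
    simp only [Word.op_after, Gen.op_word, Gen.op, LinearMap.comp_apply, LinearMap.smul_apply,
      map_smul, Pi.smul_apply, smul_eq_mul, ← mul_assoc]
    rw [show j + 1 - 1 = j - 1 + 1 by omega, capOp_succ_cupOp _ _ (by rintro rfl; simp at hx),
      mul_comm (cupScale _), capScale_succ_mul_cupScale]
    simp [Word.op]
  | alpha_beta_gt n i j hij hne hj hi hi' hj' =>
    have := hi'.rank_eq; have := hi.rank_eq; have := hi.le; have := hj.one_le
    simp only [Obj.rank] at *
    have hne' : j = 1 → i ≠ 2 * (n + 1) + 2 := fun h h' => hne (by rw [h, h'])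
    simp only [Word.op_after, Gen.op_word, Gen.op, LinearMap.comp_apply, LinearMap.smul_apply,
      map_smul, Pi.smul_apply, smul_eq_mul]
    rw [capOp_cupOp_of_gt φ (by omega) (by omega), capScale_sub_two (by omega),
      show i - 1 - 2 = i - 2 - 1 by omega]
    ring
  | alpha_beta_last_first n hj hi =>
    simp only [Obj.rank] at hx
    simp only [Word.op_after, Gen.op_word, Gen.op, LinearMap.comp_apply,
      LinearMap.smul_apply, map_smul, Pi.smul_apply, smul_eq_mul, rotOp_apply]
    rw [show 2 * (n + 1) + 2 - 1 = x.length + 1 by omega,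
      capOp_last_cupOp_zero _ (by rintro rfl; simp at hx)]
    have : ¬ Odd (2 * (n + 1) + 2) := Nat.not_odd_iff_even.2 ⟨n + 2, by ring⟩
    simp only [capScale, cupScale, this, if_false, odd_one, if_true]
    ring
  | deltaPlus_comm g => simp [Word.op_after, Gen.op_word, Gen.op]
  | deltaMinus_comm g => simp [Word.op_after, Gen.op_word, Gen.op]

lemma Rel.op_eq_comp {a b c d : Obj} (f : Word a b) (g : Word c d) {v w : Word b c}
    (h : Rel v w) (φ : List Bool → ℚ) {x : List Bool} (hx : x.length = 2 * d.rank) :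
    Word.op (Quiver.Path.comp f (Quiver.Path.comp v g)) φ x =
      Word.op (Quiver.Path.comp f (Quiver.Path.comp w g)) φ x := by
  simp only [Word.op_comp, LinearMap.comp_apply]
  exact Word.op_congr _ (fun z hz => Rel.op_eq h _ hz) hx

lemma Word.op_eq_of_eval_eq {a b : Obj} {v w : Word a b} (h : v.eval = w.eval)
    (φ : List Bool → ℚ) {x : List Bool} (hx : x.length = 2 * b.rank) : v.op φ x = w.op φ x := by
  have h' : Quot.mk (@HomRel.CompClosure (Paths Obj) _ homRel a b) v =
      Quot.mk (@HomRel.CompClosure (Paths Obj) _ homRel a b) w := h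
  -- Morphisms of the quotient category form a `Quot`; the operator descends to it once its output
  -- is restricted to states of the target.
  have := congrArg (Quot.lift
    (fun (u : Word a b) (y : {y : List Bool // y.length = 2 * b.rank}) => u.op φ y.1) ?_) h'
  · exact congrFun this ⟨x, hx⟩
  · rintro _ _ ⟨_, _, f, m₁, m₂, g, hm⟩
    funext y
    exact Rel.op_eq_comp f g hm φ y.2

/-! ### Strict maxima at positively oriented half diagrams -/

/-- The orientation of a half diagram in which every cap, and every strand of `x`, is positive. -/
def canon (l : List ℕ) (x : List Bool) : List Bool := l.foldr (fun i x => ins true (i - 1) x) x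

lemma canon_nil (x : List Bool) : canon [] x = x := rfl

lemma canon_cons (i : ℕ) (l : List ℕ) (x : List Bool) :
    canon (i :: l) x = ins true (i - 1) (canon l x) := rfl

lemma canon_append (l l' : List ℕ) (x : List Bool) : canon (l ++ l') x = canon l (canon l' x) :=
  List.foldr_append

lemma length_canon (l : List ℕ) (x : List Bool) :
    (canon l x).length = x.length + 2 * l.length := by
  induction l with
  | nil => rfl
  | cons i l ih => rw [canon_cons, length_ins, ih, List.length_cons]; ring

lemma AlphaWord.rank_eq {a : Obj} : ∀ {b : Obj} (w : AlphaWord a b),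
    a.rank = b.rank + w.indices.length
  | _, .nil _ => rfl
  | _, .snoc w i h => by
    have := w.rank_eq
    have := h.rank_eq
    simp only [AlphaWord.indices, List.length_append, List.length_singleton]
    omega

/-- `φ` has a positive strict maximum at `x₀` among the lists of length `L`. -/
def StrictMaxAt (φ : List Bool → ℚ) (L : ℕ) (x₀ : List Bool) : Prop :=
  x₀.length = L ∧ 0 < φ x₀ ∧ ∀ x, x.length = L → x ≠ x₀ → 0 ≤ φ x ∧ φ x < φ x₀

/-- Proportionality at the two maximum points is enough: each strict inequality would contradict the
other. -/
lemma StrictMaxAt.unique {φ ψ : List Bool → ℚ} {L : ℕ} {x₀ x₁ : List Bool} {c d : ℚ}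
    (h₀ : StrictMaxAt φ L x₀) (h₁ : StrictMaxAt ψ L x₁) (hc : 0 < c) (hd : 0 < d)
    (e₀ : c * φ x₀ = d * ψ x₀) (e₁ : c * φ x₁ = d * ψ x₁) : x₀ = x₁ := by
  by_contra hne
  have l₀ := (h₀.2.2 x₁ h₁.1 (Ne.symm hne)).2
  have l₁ := (h₁.2.2 x₀ h₀.1 hne).2
  have := mul_lt_mul_of_pos_left l₀ hc
  have := mul_lt_mul_of_pos_left l₁ hd
  linarith

/-- The positive insertion doubles a value and the negative one keeps it, so the maximum moves to
the positive insertion into the old maximum and stays strict. -/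
lemma StrictMaxAt.cupOp {φ : List Bool → ℚ} {L : ℕ} {x₀ : List Bool} (h : StrictMaxAt φ L x₀)
    (p : ℕ) : StrictMaxAt (cupOp p φ) (L + 2) (ins true p x₀) := by
  obtain ⟨hl, hp, hm⟩ := h
  refine ⟨by rw [length_ins, hl], ?_, ?_⟩
  · rw [cupOp_ins]; simp [wt, hp]
  · intro y hy hne
    rw [cupOp_ins]
    by_cases hyr : ∃ o x, y = ins o p x
    · obtain ⟨o, x, rfl⟩ := hyr
      rw [length_ins] at hy
      have hxl : x.length = L := by omega
      rw [cupOp_ins]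
      by_cases hx : x = x₀
      · subst hx
        cases o
        · simp only [wt]; constructor <;> simp <;> linarith
        · exact absurd rfl hne
      · obtain ⟨h1, h2⟩ := hm x hxl hx
        cases o <;> simp only [wt] <;> constructor <;> simp <;> linarith
    · push Not at hyr
      rw [cupOp_eq_zero _ _ hyr]
      simp [wt, hp]

lemma StrictMaxAt.smul {φ : List Bool → ℚ} {L : ℕ} {x₀ : List Bool} (h : StrictMaxAt φ L x₀)
    {c : ℚ} (hc : 0 < c) : StrictMaxAt (c • φ) L x₀ := by
  refine ⟨h.1, mul_pos hc h.2.1, fun x hx hne => ?_⟩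
  obtain ⟨h1, h2⟩ := h.2.2 x hx hne
  exact ⟨mul_nonneg hc.le h1, mul_lt_mul_of_pos_left h2 hc⟩

lemma AlphaWord.strictMaxAt_star {a : Obj} : ∀ {b : Obj} (w : AlphaWord a b)
    {φ : List Bool → ℚ} {x₀ : List Bool} (_ : StrictMaxAt φ (2 * b.rank) x₀),
    StrictMaxAt (w.star.op φ) (2 * a.rank) (canon w.indices x₀)
  | _, .nil _, _, _, h => h
  | _, .snoc w i hi, φ, x₀, h => by
    rw [AlphaWord.star, Word.op_after, AlphaWord.indices, canon_append]
    refine w.strictMaxAt_star ?_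
    rw [hi.rank_eq]
    exact (h.cupOp (i - 1)).smul (cupScale_pos i)

lemma strictMaxAt_single {L : ℕ} {x : List Bool} (h : x.length = L) :
    StrictMaxAt (Pi.single x 1) L x := by
  refine ⟨h, by simp, fun y _ hy => ?_⟩
  simp [Pi.single_eq_of_ne hy]

lemma cupOp_single (p : ℕ) (z : List Bool) :
    cupOp p (Pi.single z 1) =
      wt true • Pi.single (ins true p z) 1 + wt false • Pi.single (ins false p z) 1 := by
  ext y
  simp only [Pi.add_apply, Pi.smul_apply, smul_eq_mul]
  by_cases hy : ∃ o x, y = ins o p x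
  · obtain ⟨o, x, rfl⟩ := hy
    rw [cupOp_ins]
    by_cases hx : x = z
    · subst hx
      cases o
      · have : ins false p x ≠ ins true p x := fun h => by simpa using (ins_inj h).1
        simp [Pi.single_eq_of_ne this]
      · have : ins true p x ≠ ins false p x := fun h => by simpa using (ins_inj h).1
        simp [Pi.single_eq_of_ne this]
    · rw [Pi.single_eq_of_ne hx, Pi.single_eq_of_ne fun h => hx (ins_inj h).2,
        Pi.single_eq_of_ne fun h => hx (ins_inj h).2]
      simp
  · push Not at hy
    rw [cupOp_eq_zero _ _ hy, Pi.single_eq_of_ne (hy _ _), Pi.single_eq_of_ne (hy _ _)]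
    simp

/-- Up to a positive scalar, the operator of a word of Type I is the transpose of the operator
of the corresponding word of Type III. -/
lemma AlphaWord.op_transpose {a : Obj} : ∀ {b : Obj} (w : AlphaWord a b),
    ∃ c : ℚ, 0 < c ∧ ∀ x z, w.toWord.op (Pi.single x 1) z = c * w.star.op (Pi.single z 1) x
  | _, .nil _ => by
    refine ⟨1, one_pos, fun x z => ?_⟩
    simp only [AlphaWord.toWord, AlphaWord.star, Word.op, LinearMap.id_apply, one_mul]
    by_cases h : x = z
    · subst h; rfl
    · rw [Pi.single_eq_of_ne h, Pi.single_eq_of_ne (Ne.symm h)]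
  | _, .snoc w i hi => by
    obtain ⟨c, hc, h⟩ := w.op_transpose
    refine ⟨capScale i * c / (2 * cupScale i), ?_, fun x z => ?_⟩
    · have := capScale_pos i
      have := cupScale_pos i
      positivity
    · have := (cupScale_pos i).ne'
      simp only [AlphaWord.toWord, AlphaWord.star, Word.op_after, Gen.op_word, Gen.op,
        LinearMap.comp_apply, LinearMap.smul_apply, map_smul, map_add, cupOp_single, Pi.smul_apply,
        Pi.add_apply, smul_eq_mul, capOp_apply, h]
      field_simp

/-! ### Conservation of the total orientation -/

/-- The total orientation of a state. -/
def spin (x : List Bool) : ℤ := x.count true - x.count false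

lemma spin_rotate (x : List Bool) (k : ℕ) : spin (x.rotate k) = spin x := by
  simp only [spin, (List.rotate_perm x k).count_eq]

lemma spin_ins (o : Bool) (p : ℕ) (x : List Bool) : spin (ins o p x) = spin x := by
  rw [← spin_rotate _ p, ins_rotate, ← spin_rotate x p]
  cases o <;> simp [spin]

lemma spin_canon (l : List ℕ) (x : List Bool) : spin (canon l x) = spin x := by
  induction l with
  | nil => rfl
  | cons i l ih => rw [canon_cons, spin_ins, ih]

lemma spin_le_length (x : List Bool) : spin x ≤ x.length := by
  have := List.count_le_length (a := true) (l := x)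
  simp only [spin]
  omega

lemma eq_replicate_of_spin {x : List Bool} (h : spin x = x.length) :
    x = List.replicate x.length true := by
  have h1 := List.count_le_length (a := true) (l := x)
  simp only [spin] at h
  have h2 : x.count true = x.length := by omega
  rw [List.eq_replicate_iff]
  exact ⟨rfl, fun b hb => (List.count_eq_length.1 h2 b hb).symm⟩

lemma spin_replicate (n : ℕ) : spin (List.replicate n true) = n := by
  simp [spin, List.count_replicate]

/-- `φ` is supported on states of total orientation `S`. -/
def HasSpin (S : ℤ) (φ : List Bool → ℚ) : Prop := ∀ x, spin x ≠ S → φ x = 0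

lemma hasSpin_single (x : List Bool) : HasSpin (spin x) (Pi.single x 1) := fun y hy =>
  Pi.single_eq_of_ne (fun h => hy (by rw [h])) _

lemma HasSpin.gen {S : ℤ} {φ : List Bool → ℚ} (h : HasSpin S φ) {a b : Obj} (g : Gen a b) :
    HasSpin S (g.op φ) := by
  intro x hx
  cases g with
  | alpha i hi =>
    simp only [Gen.op, LinearMap.smul_apply, Pi.smul_apply, capOp_apply]
    rw [h _ (by rwa [spin_ins]), h _ (by rwa [spin_ins])]
    simp
  | beta i hi =>
    simp only [Gen.op, LinearMap.smul_apply, Pi.smul_apply]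
    by_cases hy : ∃ o z, x = ins o (i - 1) z
    · obtain ⟨o, z, rfl⟩ := hy
      rw [spin_ins] at hx
      rw [cupOp_ins, h _ hx]
      simp
    · push Not at hy
      rw [cupOp_eq_zero _ _ hy, smul_zero]
  | tau n => exact h _ (by rwa [spin_rotate])
  | deltaPlus => simp [Gen.op, h x hx]
  | deltaMinus => simp [Gen.op, h x hx]

lemma HasSpin.word {S : ℤ} {φ : List Bool → ℚ} (h : HasSpin S φ) {a : Obj} :
    ∀ {b : Obj} (w : Word a b), HasSpin S (w.op φ)
  | _, .nil => h
  | _, .cons w g => (HasSpin.word h w).gen g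

lemma HasSpin.eq_zero {S : ℤ} {φ : List Bool → ℚ} (h : HasSpin S φ) {x : List Bool}
    (hx : (x.length : ℤ) < S) : φ x = 0 :=
  h x fun h' => by have := spin_le_length x; omega

/-- The state of `[t]` in which all strands are positive. -/
abbrev top (t : ℕ) : List Bool := List.replicate (2 * t) true

/-- Among states with `2t` letters only the all-positive one has total orientation `2t`. -/
lemma HasSpin.eq_top {t : ℕ} {φ : List Bool → ℚ} (h : HasSpin (2 * t : ℕ) φ) {x : List Bool}
    (hx : x.length = 2 * t) : φ x = (φ (top t) • (Pi.single (top t) 1 : List Bool → ℚ)) x := by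
  by_cases he : spin x = (2 * t : ℕ)
  · have := eq_replicate_of_spin (he.trans (by rw [hx]))
    rw [hx] at this
    rw [this]
    simp
  · rw [h x he, Pi.smul_apply, Pi.single_eq_of_ne, smul_zero]
    rintro rfl
    exact he (spin_replicate _)

/-! ### Type II words on the all-positive state -/

namespace RotWord

lemma rank_eq : ∀ {a b : Obj} (_ : RotWord a b), a.rank = b.rank
  | _, _, tauPow _ _ => rfl
  | _, _, idPlus => rfl
  | _, _, idMinus => rfl
  | _, _, sigmaPlus w => w.rank_eq
  | _, _, sigmaMinus w => w.rank_eq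

/-- The number of letters `σ_±`. -/
def loops : ∀ {a b : Obj} (_ : RotWord a b), ℕ
  | _, _, tauPow _ _ => 0
  | _, _, idPlus => 0
  | _, _, idMinus => 0
  | _, _, sigmaPlus w => w.loops + 1
  | _, _, sigmaMinus w => w.loops + 1

/-- For a loop around the annulus the cap and the cup see opposite orientations, so each of the two
orientations contributes 2 · 1 / 2. -/
lemma capOp_cupOp_nil {p q : ℕ} (h : ∀ o, ins o p [] = ins (!o) q []) (φ : List Bool → ℚ) :
    capOp p (cupOp q φ) [] = 2 * φ [] := by
  rw [capOp_apply, h, h, cupOp_ins, cupOp_ins]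
  simp [wt]; ring

/-- Powers of `τ` fix the all-positive state and hence are invisible here; on `[0±]` the number of
letters `σ_±` is recorded by the power of 2. -/
lemma op_top {a : Obj} : ∀ {b : Obj} (w : RotWord a b) {z : List Bool} (_ : z.length = 2 * b.rank),
    w.toWord.op (Pi.single (top a.rank) 1) z = 2 ^ w.loops * (Pi.single (top a.rank) 1 : _ → ℚ) z
  | _, tauPow n s, z, hz => by
    simp only [toWord, Gen.op_pow, Gen.op, rotOp_pow_apply, loops, pow_zero, one_mul]
    by_cases h : z = top (Obj.succ n).rank
    · subst h
      rw [List.rotate_replicate]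
    · rw [Pi.single_eq_of_ne h, Pi.single_eq_of_ne]
      intro h'
      apply h
      apply List.rotate_injective (2 * s)
      change z.rotate _ = List.rotate _ _
      rw [h', List.rotate_replicate]
  | _, idPlus, z, hz => by simp [toWord, Word.op, loops]
  | _, idMinus, z, hz => by simp [toWord, Word.op, loops]
  | _, sigmaPlus w, z, hz => by
    obtain rfl : z = [] := by simpa [Obj.rank] using hz
    have := w.op_top (z := []) rfl
    simp only [toWord, Word.op_after, Gen.op_word, Gen.op, LinearMap.comp_apply,
      LinearMap.smul_apply, map_smul, Pi.smul_apply]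
    rw [capOp_cupOp_nil (by intro o; cases o <;> rfl), this]
    simp [capScale, cupScale, loops, pow_succ, Nat.odd_iff]
    ring
  | _, sigmaMinus w, z, hz => by
    obtain rfl : z = [] := by simpa [Obj.rank] using hz
    have := w.op_top (z := []) rfl
    simp only [toWord, Word.op_after, Gen.op_word, Gen.op, LinearMap.comp_apply,
      LinearMap.smul_apply, map_smul, Pi.smul_apply]
    rw [capOp_cupOp_nil (by intro o; cases o <;> rfl), this]
    simp [capScale, cupScale, loops, pow_succ, Nat.odd_iff]
    ring

end RotWord

/-! ### Matrix entries of a standard form -/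

namespace StandardForm

variable {m n : Obj}

/-- The scalar by which the closed loops of a standard form act. -/
def scalar (s : StandardForm m n) : ℚ := (15 / 2) ^ s.cPlus * (5 / 6) ^ s.cMinus * 2 ^ s.two.loops

lemma scalar_pos (s : StandardForm m n) : 0 < s.scalar := by unfold scalar; positivity

lemma op_toWord (s : StandardForm m n) (φ : List Bool → ℚ) :
    s.toWord.op φ = ((15 / 2 : ℚ) ^ s.cPlus * (5 / 6) ^ s.cMinus) •
      s.threeStar.toAlphaWord.star.op (s.two.toWord.op (s.one.toAlphaWord.toWord.op φ)) := by
  simp only [toWord, Word.op_after, Gen.op_pow, Gen.op, LinearMap.comp_apply, smul_pow,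
    LinearMap.smul_apply, mul_smul]
  congr 1
  rw [← Module.End.one_eq_id, one_pow, one_pow]
  rfl

/-- By conservation of the total orientation, `w_I` sends the state `x` to a multiple of the
all-positive state. The entries therefore form a matrix of rank at most one. -/
lemma op_single (s : StandardForm m n) {x y : List Bool} (hx : spin x = (2 * s.src.rank : ℕ))
    (hy : y.length = 2 * n.rank) :
    s.toWord.op (Pi.single x 1) y = s.scalar *
      s.one.toAlphaWord.toWord.op (Pi.single x 1) (top s.src.rank) *
        s.threeStar.toAlphaWord.star.op (Pi.single (top s.src.rank) 1) y := by
  have h₁ := (hasSpin_single x).word s.one.toAlphaWord.toWord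
  rw [hx] at h₁
  rw [op_toWord, Pi.smul_apply, Word.op_congr (ψ :=
    (2 ^ s.two.loops * s.one.toAlphaWord.toWord.op (Pi.single x 1) (top s.src.rank)) •
      Pi.single (top s.src.rank) 1) s.threeStar.toAlphaWord.star _ hy]
  · simp only [map_smul, Pi.smul_apply, smul_eq_mul, scalar]
    ring
  · intro z hz
    rw [Word.op_congr s.two.toWord (fun w hw => h₁.eq_top hw) hz, map_smul, Pi.smul_apply,
      RotWord.op_top _ hz]
    simp only [Pi.smul_apply, smul_eq_mul]
    ring

/-- No state of the middle object has a total orientation exceeding its length. -/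
lemma op_single_eq_zero (s : StandardForm m n) {x y : List Bool}
    (hx : (2 * s.src.rank : ℕ) < spin x) (hy : y.length = 2 * n.rank) :
    s.toWord.op (Pi.single x 1) y = 0 := by
  have h₁ := ((hasSpin_single x).word s.one.toAlphaWord.toWord).word s.two.toWord
  rw [op_toWord, Pi.smul_apply, Word.op_congr (ψ := 0) s.threeStar.toAlphaWord.star _ hy]
  · simp
  · intro z hz
    apply h₁.eq_zero
    rw [hz, ← s.two.rank_eq]
    exact hx

/-- The states in which the caps of `w_I`, respectively the cups of `w_III`, are positive. -/
def lower (s : StandardForm m n) : List Bool := canon s.one.toAlphaWord.indices (top s.src.rank)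

/-- See `StandardForm.lower`. -/
def upper (s : StandardForm m n) : List Bool :=
  canon s.threeStar.toAlphaWord.indices (top s.tgt.rank)

lemma strictMaxAt_upper (s : StandardForm m n) :
    StrictMaxAt (s.threeStar.toAlphaWord.star.op (Pi.single (top s.src.rank) 1))
      (2 * n.rank) s.upper := by
  rw [s.two.rank_eq]
  exact AlphaWord.strictMaxAt_star _ (strictMaxAt_single (by simp))

/-- As a function of the input, the entry of `w_I` is, by transposition, a positive multiple of the
value of the cup word `w_I^*`, whose maximum is known. -/
lemma strictMaxAt_lower (s : StandardForm m n) :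
    StrictMaxAt (fun x => s.one.toAlphaWord.toWord.op (Pi.single x 1) (top s.src.rank))
      (2 * m.rank) s.lower := by
  obtain ⟨c, hc, h⟩ := s.one.toAlphaWord.op_transpose
  have := (AlphaWord.strictMaxAt_star s.one.toAlphaWord (strictMaxAt_single
    (x := top s.src.rank) (by simp))).smul hc
  simp only [h]
  exact this

lemma spin_lower (s : StandardForm m n) : spin s.lower = (2 * s.src.rank : ℕ) := by
  rw [lower, spin_canon, spin_replicate]

lemma op_single_pos (s : StandardForm m n) : 0 < s.toWord.op (Pi.single s.lower 1) s.upper := by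
  rw [s.op_single s.spin_lower s.strictMaxAt_upper.1]
  exact mul_pos (mul_pos s.scalar_pos s.strictMaxAt_lower.2.1) s.strictMaxAt_upper.2.1

/-- A middle object of larger rank would let through a state that the other form annihilates. -/
lemma rank_src_le {s s' : StandardForm m n} (h : s.toWord.eval = s'.toWord.eval) :
    s'.src.rank ≤ s.src.rank := by
  by_contra hlt
  have h0 := s.op_single_eq_zero (x := s'.lower) (y := s'.upper)
    (by rw [s'.spin_lower]; push_cast; omega) s'.strictMaxAt_upper.1
  rw [Word.op_eq_of_eval_eq h _ s'.strictMaxAt_upper.1] at h0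
  exact s'.op_single_pos.ne' h0

lemma rank_src_eq {s s' : StandardForm m n} (h : s.toWord.eval = s'.toWord.eval) :
    s.src.rank = s'.src.rank := le_antisymm (rank_src_le h.symm) (rank_src_le h)

lemma op_single_eq {s s' : StandardForm m n} (h : s.toWord.eval = s'.toWord.eval)
    {x y : List Bool} (hx : spin x = (2 * s.src.rank : ℕ)) (hy : y.length = 2 * n.rank) :
    s.scalar * s.one.toAlphaWord.toWord.op (Pi.single x 1) (top s.src.rank) *
        s.threeStar.toAlphaWord.star.op (Pi.single (top s.src.rank) 1) y =
      s'.scalar * s'.one.toAlphaWord.toWord.op (Pi.single x 1) (top s'.src.rank) *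
        s'.threeStar.toAlphaWord.star.op (Pi.single (top s'.src.rank) 1) y := by
  rw [← s.op_single hx hy, ← s'.op_single (by rw [hx, rank_src_eq h]) hy,
    Word.op_eq_of_eval_eq h _ hy]

lemma upper_eq {s s' : StandardForm m n} (h : s.toWord.eval = s'.toWord.eval) :
    s.upper = s'.upper := by
  have e := fun y hy => op_single_eq h (x := s.lower) (y := y) s.spin_lower hy
  have p := mul_pos s.scalar_pos s.strictMaxAt_lower.2.1
  -- The right side of `e` is positive at `s.upper` because the left side is, and its last factor is
  -- nonnegative there; so the factor in front of it is positive.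
  have p' : 0 < s'.scalar * s'.one.toAlphaWord.toWord.op (Pi.single s.lower 1)
      (top s'.src.rank) := by
    have e₀ := e _ s.strictMaxAt_upper.1
    have q := mul_pos p s.strictMaxAt_upper.2.1
    rw [e₀] at q
    refine pos_of_mul_pos_left q ?_
    by_cases hu : s.upper = s'.upper
    · rw [hu]; exact s'.strictMaxAt_upper.2.1.le
    · exact (s'.strictMaxAt_upper.2.2 _ s.strictMaxAt_upper.1 hu).1
  exact s.strictMaxAt_upper.unique s'.strictMaxAt_upper p p' (e _ s.strictMaxAt_upper.1)
    (e _ s'.strictMaxAt_upper.1)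

lemma lower_eq {s s' : StandardForm m n} (h : s.toWord.eval = s'.toWord.eval) :
    s.lower = s'.lower := by
  have hu := upper_eq h
  have e := fun x hx => op_single_eq h (x := x) (y := s.upper) hx s.strictMaxAt_upper.1
  have p := mul_pos s.scalar_pos s.strictMaxAt_upper.2.1
  have p' := mul_pos s'.scalar_pos s'.strictMaxAt_upper.2.1
  rw [← hu] at p'
  refine s.strictMaxAt_lower.unique s'.strictMaxAt_lower p p' ?_ ?_
  · have := e _ s.spin_lower
    linarith
  · have := e _ (s'.spin_lower.trans (by rw [rank_src_eq h]))
    linarith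

/-- Two standard forms of a morphism with the same words of Type I and III have the same scalar. -/
lemma scalar_eq {s s' : StandardForm m n} (h : s.toWord.eval = s'.toWord.eval)
    (h₁ : ∀ φ, s.one.toAlphaWord.toWord.op φ = s'.one.toAlphaWord.toWord.op φ)
    (h₃ : ∀ φ, s.threeStar.toAlphaWord.star.op φ = s'.threeStar.toAlphaWord.star.op φ) :
    s.scalar = s'.scalar := by
  have e := op_single_eq h s.spin_lower s.strictMaxAt_upper.1
  rw [← rank_src_eq h, ← h₁, ← h₃] at e
  exact mul_right_cancel₀ s.strictMaxAt_lower.2.1.ne'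
    (mul_right_cancel₀ s.strictMaxAt_upper.2.1.ne' e)

end StandardForm

/-- The valuations at (2, 3, 5) of 15/2, 5/6 and 2 are (-1, 1, 1), (-1, -1, 1) and (1, 0, 0), which
are linearly independent. -/
lemma loop_scalars_injective {a b c a' b' c' : ℕ}
    (h : ((15 / 2 : ℚ)) ^ a * (5 / 6) ^ b * 2 ^ c = (15 / 2) ^ a' * (5 / 6) ^ b' * 2 ^ c') :
    a = a' ∧ b = b' ∧ c = c' := by
  have h15 : (15 : ℚ) = 3 * 5 := by norm_num
  have h6 : (6 : ℚ) = 2 * 3 := by norm_num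
  have key : ∀ (p : ℕ) [Fact p.Prime] (a b c : ℕ),
      padicValRat p (((15 / 2 : ℚ)) ^ a * (5 / 6) ^ b * 2 ^ c) =
      a * (padicValRat p 3 + padicValRat p 5 - padicValRat p 2) +
      b * (padicValRat p 5 - padicValRat p 2 - padicValRat p 3) + c * padicValRat p 2 := by
    intro p _ a b c
    rw [padicValRat.mul (by positivity) (by positivity),
      padicValRat.mul (by positivity) (by positivity), padicValRat.pow, padicValRat.pow, padicValRat.pow,
      padicValRat.div (by norm_num) (by norm_num), padicValRat.div (by norm_num) (by norm_num),
      h15, h6, padicValRat.mul (by norm_num) (by norm_num),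
      padicValRat.mul (by norm_num) (by norm_num)]
    ring
  have v : ∀ (p q : ℕ) [Fact p.Prime] [Fact q.Prime],
      padicValRat p (q : ℚ) = if p = q then 1 else 0 := by
    intro p q hp hq
    rw [padicValRat.of_nat]
    split_ifs with h
    · subst h; simp
    · rw [padicValNat_primes h]; rfl
  have : Fact (Nat.Prime 2) := ⟨Nat.prime_two⟩
  have : Fact (Nat.Prime 3) := ⟨Nat.prime_three⟩
  have : Fact (Nat.Prime 5) := ⟨Nat.prime_five⟩
  have h2 := congrArg (padicValRat 2) h
  have h3 := congrArg (padicValRat 3) h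
  have h5 := congrArg (padicValRat 5) h
  simp only [key] at h2 h3 h5
  have v2 := fun p [Fact (Nat.Prime p)] => v p 2
  have v3 := fun p [Fact (Nat.Prime p)] => v p 3
  have v5 := fun p [Fact (Nat.Prime p)] => v p 5
  push_cast at v2 v3 v5
  simp only [v2, v3, v5] at h2 h3 h5
  norm_num at h2 h3 h5
  omega

/-! ### Recovering a standard decomposition from a lattice path -/

lemma ins_of_le (o : Bool) {p : ℕ} {x : List Bool} (h : p ≤ x.length) :
    ins o p x = x.take p ++ o :: (!o) :: x.drop p := by
  refine (eq_ins ?_).symm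
  rw [rotate_append_of_length (by simpa using h), List.rotate_eq_drop_append_take h]
  simp

/-- The pair straddles the cut of the circle: its first letter comes last and its second letter
comes first. This is the only place where the cyclic insertion differs from a linear one. -/
lemma ins_last (o : Bool) (x : List Bool) :
    ins o (x.length + 1) x = (!o) :: (x.rotate 1 ++ [o]) := by
  refine (eq_ins ?_).symm
  rw [rotate_length_add, ← List.cons_append, rotate_append_of_length (by simp)]
  rfl

/-- The height reached from `h` along the steps `x`, if it stays nonnegative. -/
def run : ℕ → List Bool → Option ℕ
  | h, [] => some h
  | h, true :: x => run (h + 1) x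
  | 0, false :: _ => none
  | h + 1, false :: x => run h x

lemma run_append (h : ℕ) (u v : List Bool) : run h (u ++ v) = (run h u).bind (run · v) := by
  induction u generalizing h with
  | nil => rfl
  | cons a u ih =>
    cases a
    · cases h
      · rfl
      · exact ih _
    · exact ih _

lemma run_add {h k : ℕ} {x : List Bool} (c : ℕ) (hx : run h x = some k) :
    run (h + c) x = some (k + c) := by
  induction x generalizing h with
  | nil => simp only [run, Option.some.injEq] at hx ⊢; omega
  | cons a x ih =>
    cases a
    · cases h with
      | zero => simp [run] at hx
      | succ h =>
        rw [show h + 1 + c = h + c + 1 by ring]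
        exact ih hx
    · have := ih (h := h + 1) hx
      rw [show h + 1 + c = h + c + 1 by ring] at this
      exact this

lemma run_replicate_ne_none (n h : ℕ) : run h (List.replicate n true) ≠ none := by
  induction n generalizing h with
  | zero => simp [run]
  | succ n ih => exact ih _

/-- A peak, one step up and one step down, changes neither the end height nor the condition of
staying nonnegative. -/
lemma run_ins (h : ℕ) {p : ℕ} {x : List Bool} (hp : p ≤ x.length) :
    run h (ins true p x) = run h x := by
  rw [ins_of_le _ hp, run_append]
  conv_rhs => rw [← List.take_append_drop p x, run_append]
  rfl

/-- The displayed `false` is the first step below 0, so it is determined by the whole list. -/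
lemma append_false_inj {D D' z z' : List Bool} (hD : run 0 D = some 0) (hD' : run 0 D' = some 0)
    (h : D ++ false :: z = D' ++ false :: z') : D = D' ∧ z = z' := by
  have key : ∀ {D D' z z' e : List Bool}, run 0 D = some 0 → run 0 D' = some 0 → D' = D ++ e →
      false :: z = e ++ false :: z' → e = [] := by
    intro D D' z z' e hD hD' h₁ h₂
    rcases e with _ | ⟨a, e⟩
    · rfl
    · obtain ⟨rfl, -⟩ := List.cons.inj h₂
      rw [h₁, run_append, hD] at hD'
      simp [run] at hD'
  rcases List.append_eq_append_iff.1 h with ⟨e, h₁, h₂⟩ | ⟨e, h₁, h₂⟩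
  · obtain rfl := key hD hD' h₁ h₂
    simp_all
  · obtain rfl := key hD' hD h₁ h₂
    simp_all

/-- The displayed `true` is the last ascent that is never undone: if it lay inside `D`, the path `D`
would end above 0. -/
lemma append_true_inj {D D' z z' : List Bool} (hD : run 0 D = some 0) (hD' : run 0 D' = some 0)
    (h : z ++ true :: D = z' ++ true :: D') : D = D' ∧ z = z' := by
  have key : ∀ {D D' e : List Bool}, run 0 D = some 0 → run 0 D' = some 0 →
      true :: D = e ++ true :: D' → e = [] := by
    intro D D' e hD hD' h₂
    rcases e with _ | ⟨a, e⟩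
    · rfl
    · have h₃ : D = e ++ true :: D' := (List.cons.inj h₂).2
      rw [h₃, run_append] at hD
      rcases he : run 0 e with _ | k
      · simp [he] at hD
      · have := run_add (k + 1) hD'
        rw [he, Option.bind_some, run] at hD
        rw [Nat.zero_add] at this
        rw [hD] at this
        simp at this
  rcases List.append_eq_append_iff.1 h with ⟨e, h₁, h₂⟩ | ⟨e, h₁, h₂⟩
  · obtain rfl := key hD hD' h₂
    simp_all
  · obtain rfl := key hD' hD h₂
    simp_all

/-- Lists of indices of ordered, possibly empty words on `[m]`. -/
def OrdList : ℕ → List ℕ → Prop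
  | _, [] => True
  | m, i :: l => 1 ≤ i ∧ i < 2 * m ∧ (∀ j ∈ l, j < i) ∧ OrdList (m - 1) l

lemma OrdList.of_getElem {m : ℕ} {l : List ℕ} (h₁ : ∀ i ∈ l, 1 ≤ i) (h₂ : l.Pairwise (· > ·))
    (h₃ : ∀ (r : ℕ) (hr : r < l.length), l[r] + 2 * (r + 1) < 2 * m + 2) : OrdList m l := by
  induction l generalizing m with
  | nil => trivial
  | cons i l ih =>
    rw [List.pairwise_cons] at h₂
    have h0 := h₃ 0 (by simp)
    simp only [List.getElem_cons_zero] at h0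
    refine ⟨h₁ i (by simp), by omega, fun j hj => h₂.1 j hj,
      ih (fun j hj => h₁ j (by simp [hj])) h₂.2 fun r hr => ?_⟩
    have := h₃ (r + 1) (by simpa using hr)
    simp only [List.getElem_cons_succ] at this
    omega

lemma OrdList.getElem_lt {m : ℕ} {l : List ℕ} (h : OrdList m l) (r : ℕ) (hr : r < l.length) :
    l[r] + 2 * (r + 1) < 2 * m + 2 := by
  induction l generalizing m r with
  | nil => simp at hr
  | cons i l ih =>
    obtain ⟨h1, h2, h3, h4⟩ := h
    rcases r with _ | r
    · simp only [List.getElem_cons_zero]; omega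
    · have := ih h4 r (by simpa using hr)
      simp only [List.getElem_cons_succ]; omega

lemma OrdList.pairwise {m : ℕ} {l : List ℕ} (h : OrdList m l) : l.Pairwise (· > ·) := by
  induction l generalizing m with
  | nil => exact List.Pairwise.nil
  | cons i l ih => exact List.Pairwise.cons h.2.2.1 (ih h.2.2.2)

lemma OrdList.one_le {m : ℕ} {l : List ℕ} (h : OrdList m l) : ∀ i ∈ l, 1 ≤ i := by
  induction l generalizing m with
  | nil => simp
  | cons i l ih =>
    intro j hj
    rcases List.mem_cons.1 hj with rfl | hj
    · exact h.1
    · exact ih h.2.2.2 j hj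

lemma OrdList.run_canon {t : ℕ} {l : List ℕ} {x : List Bool} (hx : x.length = 2 * t)
    (h : OrdList (t + l.length) l) (k : ℕ) : run k (canon l x) = run k x := by
  induction l with
  | nil => rfl
  | cons i l ih =>
    obtain ⟨h1, h2, -, h4⟩ := h
    simp only [List.length_cons] at h2 h4
    rw [canon_cons, run_ins _ (by rw [length_canon]; omega), ih (by simpa using h4)]

/-- To the right of the largest index there is no further peak: the tail consists of descents
followed by ascents. -/
lemma OrdList.pairwise_drop_canon {t : ℕ} {l : List ℕ} (h : OrdList (t + l.length) l) {i : ℕ}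
    (hi : ∀ j ∈ l, j < i) :
    ((canon l (top t)).drop (i - 1)).Pairwise (fun a b => a = true → b = true) := by
  induction l generalizing i with
  | nil =>
    apply List.Pairwise.drop
    simp [canon_nil, List.pairwise_replicate]
  | cons j l ih =>
    obtain ⟨h1, h2, h3, h4⟩ := h
    simp only [List.length_cons] at h2 h4
    have hji := hi j (by simp)
    have hle : j - 1 ≤ (canon l (top t)).length := by rw [length_canon]; simp; omega
    have hd : (canon (j :: l) (top t)).drop j = false :: (canon l (top t)).drop (j - 1) := by
      rw [canon_cons, ins_of_le _ hle]
      rw [← List.singleton_append, ← List.append_assoc]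
      exact List.drop_left' (by simp; omega)
    rw [show i - 1 = j + (i - 1 - j) by omega, ← List.drop_drop, hd]
    apply List.Pairwise.drop
    exact List.Pairwise.cons (by simp) (ih (by simpa using h4) h3)

lemma count_false_canon (l : List ℕ) (x : List Bool) :
    (canon l x).count false = x.count false + l.length := by
  induction l with
  | nil => rfl
  | cons i l ih =>
    rw [canon_cons, ← (List.rotate_perm _ (i - 1)).count_eq, ins_rotate]
    simp only [Bool.not_true, List.count_cons, (List.rotate_perm _ (i - 1)).count_eq, ih]
    simp
    ring

lemma OrdList.canon_drop {t i : ℕ} {l : List ℕ} (h : OrdList (t + (i :: l).length) (i :: l)) :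
    ∃ z, (canon (i :: l) (top t)).drop (i - 1) = true :: false :: z := by
  obtain ⟨h1, h2, -, -⟩ := h
  simp only [List.length_cons] at h2
  have hle : i - 1 ≤ (canon l (top t)).length := by rw [length_canon]; simp; omega
  rw [canon_cons, ins_of_le _ hle]
  exact ⟨_, List.drop_left' (by simp; omega)⟩

/-- The first index of an ordered word is the place of the last peak of its path (`canon_drop`,
`pairwise_drop_canon`). Remove that peak and repeat. -/
lemma OrdList.canon_injective {t t' : ℕ} {l l' : List ℕ} (h : OrdList (t + l.length) l)
    (h' : OrdList (t' + l'.length) l') (e : canon l (top t) = canon l' (top t')) : l = l' := by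
  have key : ∀ {t t' i i' : ℕ} {l l' : List ℕ}, OrdList (t + (i :: l).length) (i :: l) →
      OrdList (t' + (i' :: l').length) (i' :: l') →
      canon (i :: l) (top t) = canon (i' :: l') (top t') → ¬ i < i' := by
    intro t t' i i' l l' h h' e hlt
    obtain ⟨z, hz⟩ := h'.canon_drop
    have hs := h.pairwise_drop_canon (i := i') fun j hj => by
      rcases List.mem_cons.1 hj with rfl | hj
      · exact hlt
      · exact (h.2.2.1 j hj).trans hlt
    rw [e, hz] at hs
    simp at hs
  have hlen : l.length = l'.length := by
    have := congrArg (List.count false) e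
    simpa [count_false_canon, List.count_replicate] using this
  induction l generalizing l' with
  | nil => exact (List.length_eq_zero_iff.1 hlen.symm).symm
  | cons i l ih =>
    rcases l' with _ | ⟨i', l'⟩
    · simp at hlen
    · have : i = i' := le_antisymm (not_lt.1 (key h' h e.symm)) (not_lt.1 (key h h' e))
      subst this
      rw [ih (l' := l') (by simpa using h.2.2.2) (by simpa using h'.2.2.2)
        (ins_inj (by simpa only [canon_cons] using e)).2 (by simpa using hlen)]

/-- Here the caps close up among the first `2 * l.length` points, so the remaining letters are not
touched. -/
lemma OrdList.canon_append_right {l : List ℕ} (h : OrdList l.length l) (z : List Bool) :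
    canon l z = canon l [] ++ z := by
  induction l with
  | nil => rfl
  | cons i l ih =>
    obtain ⟨h1, h2, -, h4⟩ := h
    simp only [List.length_cons, Nat.add_sub_cancel] at h2 h4
    have hl := length_canon l []
    simp only [List.length_nil] at hl
    rw [canon_cons, canon_cons, ih h4, ins_of_le _ (by simp; omega), ins_of_le _ (by omega),
      List.take_append_of_le_length (by omega), List.drop_append_of_le_length (by omega)]
    simp

lemma OrdList.canon_append_left {l : List ℕ} (h : OrdList l.length l) (z : List Bool) :
    canon (l.map (z.length + ·)) z = z ++ canon l [] := by
  induction l with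
  | nil => simp [canon_nil]
  | cons i l ih =>
    obtain ⟨h1, h2, -, h4⟩ := h
    simp only [List.length_cons, Nat.add_sub_cancel] at h2 h4
    have hl := length_canon l []
    simp only [List.length_nil] at hl
    rw [List.map_cons, canon_cons, canon_cons, ih h4, ins_of_le _ (by simp; omega),
      ins_of_le _ (by omega), show z.length + i - 1 = z.length + (i - 1) by omega,
      List.take_length_add_append, List.drop_length_add_append]
    simp

lemma OrdList.run_canon_nil {l : List ℕ} (h : OrdList l.length l) : run 0 (canon l []) = some 0 :=
  OrdList.run_canon (t := 0) rfl (by simpa using h) 0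

namespace AlphaWord

lemma one_le_of_mem {a : Obj} : ∀ {b : Obj} (w : AlphaWord a b) {i : ℕ} (_ : i ∈ w.indices), 1 ≤ i
  | _, nil _, _, h => by simp [indices] at h
  | _, snoc w j hj, i, h => by
    rcases List.mem_append.1 h with h | h
    · exact w.one_le_of_mem h
    · rw [List.mem_singleton.1 h]; exact hj.one_le

lemma indices_after {a b : Obj} (w : AlphaWord a b) :
    ∀ {c : Obj} (v : AlphaWord b c), (v.after w).indices = w.indices ++ v.indices
  | _, nil _ => by simp [after, indices]
  | _, snoc v i h => by simp [after, indices, indices_after w v]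

lemma isAlpha_right_unique {a b b' : Obj} {i : ℕ} (h : IsAlpha a i b) (h' : IsAlpha a i b') :
    b = b' := by
  cases h <;> cases h' <;> rfl

lemma ext_indices {a : Obj} : ∀ {b b' : Obj} (w : AlphaWord a b) (w' : AlphaWord a b')
    (_ : w.indices = w'.indices), (⟨b, w⟩ : Σ b, AlphaWord a b) = ⟨b', w'⟩
  | _, _, nil _, nil _, _ => rfl
  | _, _, nil _, snoc w i h, e => by simp [indices] at e
  | _, _, snoc w i h, nil _, e => by simp [indices] at e
  | _, _, snoc w i h, snoc w' i' h', e => by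
    obtain ⟨e₁, e₂⟩ := List.append_inj' e rfl
    obtain rfl : i = i' := by simpa using e₂
    cases ext_indices w w' e₁
    cases isAlpha_right_unique h h'
    rfl

lemma IsOrdered.ordList {a b : Obj} {w : AlphaWord a b} (h : w.IsOrdered) :
    OrdList (b.rank + w.indices.length) w.indices := by
  rw [← w.rank_eq]
  exact OrdList.of_getElem (fun _ => w.one_le_of_mem) h.2.1 h.2.2

/-- Since `m = n + k + l + 1`, the bounds on the `j_s` say that, after subtracting `2n + 2 + 2k`,
they satisfy the same conditions as the `i_r`: both lists are closed ordered diagrams. -/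
lemma IsWrapped.exists_ordList {a b : Obj} {w : AlphaWord a b} (h : w.IsWrapped) :
    ∃ I J : List ℕ, OrdList I.length I ∧ OrdList J.length J ∧
      w.indices = J.map (2 * b.rank + 2 + 2 * I.length + ·) ++ I ++ [2 * b.rank + 2] := by
  obtain ⟨I, J, e, hp, hI, hJ⟩ := h
  have hw := fun i => w.one_le_of_mem (i := i)
  have hr := w.rank_eq
  rw [List.pairwise_append] at hp
  rw [e] at hw hr
  simp only [List.length_append, List.length_singleton] at hr
  have hJ' : ∀ j ∈ J, 2 * b.rank + 2 + 2 * I.length < j := by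
    intro j hj
    obtain ⟨s, hs, rfl⟩ := List.getElem_of_mem hj
    have := hJ s hs
    omega
  refine ⟨I, J.map (· - (2 * b.rank + 2 + 2 * I.length)),
    OrdList.of_getElem (fun i hi => hw i (by simp [hi])) hp.2.1 (fun r hr => by
      have := hI r hr; omega), ?_, ?_⟩
  · apply OrdList.of_getElem
    · intro i hi
      obtain ⟨j, hj, rfl⟩ := List.mem_map.1 hi
      have := hJ' j hj
      omega
    · rw [List.pairwise_map]
      refine hp.1.imp_of_mem fun {x y} hx hy hxy => ?_
      have := hJ' x hx
      have := hJ' y hy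
      omega
    · intro r hr'
      simp only [List.length_map] at hr'
      have := hJ r hr'
      simp only [List.getElem_map, List.length_map]
      omega
  · rw [e, List.map_map]
    congr 2
    conv_lhs => rw [← List.map_id J]
    apply List.map_congr_left
    intro j hj
    have := hJ' j hj
    simp only [id, Function.comp_apply]
    omega

end AlphaWord

/-- The cap across the cut has its feet at the displayed `false` and `true`; the caps of `I` lie
before the first foot and those of `J` after the second. -/
lemma canon_wrapped {I J : List ℕ} (hI : OrdList I.length I) (hJ : OrdList J.length J)
    (x : List Bool) :
    canon (J.map (x.length + 2 + 2 * I.length + ·) ++ I ++ [x.length + 2]) x =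
      canon I [] ++ false :: (x.rotate 1 ++ true :: canon J []) := by
  rw [canon_append, canon_append, canon_cons, canon_nil, show x.length + 2 - 1 = x.length + 1 by rfl,
    ins_last]
  set z := canon I ((!true) :: (x.rotate 1 ++ [true])) with hz
  have hzl : z.length = x.length + 2 + 2 * I.length := by rw [hz, length_canon]; simp
  rw [← hzl, hJ.canon_append_left, hz, hI.canon_append_right]
  simp

lemma OrdList.canon_nil_injective {l l' : List ℕ} (h : OrdList l.length l)
    (h' : OrdList l'.length l') (e : canon l [] = canon l' []) : l = l' :=
  OrdList.canon_injective (t := 0) (t' := 0) (by simpa using h) (by simpa using h') e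

namespace StdDecomp

lemma run_canon_of_isOrdered {a b : Obj} {w : AlphaWord a b} (h : w.IsOrdered) :
    run 0 (canon w.indices (top b.rank)) ≠ none := by
  rw [h.ordList.run_canon (by simp)]
  exact run_replicate_ne_none _ _

lemma exists_canon_cons {a b c : Obj} {w : AlphaWord a b} (hw : w.IsWrapped) (d : StdDecomp b c) :
    ∃ I J : List ℕ, OrdList I.length I ∧ OrdList J.length J ∧
      w.indices = J.map (2 * b.rank + 2 + 2 * I.length + ·) ++ I ++ [2 * b.rank + 2] ∧
      canon (cons w hw d).toAlphaWord.indices (top c.rank) = canon I [] ++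
        false :: ((canon d.toAlphaWord.indices (top c.rank)).rotate 1 ++ true :: canon J []) := by
  obtain ⟨I, J, hI, hJ, e⟩ := hw.exists_ordList
  refine ⟨I, J, hI, hJ, e, ?_⟩
  have hl : 2 * b.rank = (canon d.toAlphaWord.indices (top c.rank)).length := by
    rw [length_canon, d.toAlphaWord.rank_eq]; simp; ring
  rw [toAlphaWord, AlphaWord.indices_after, canon_append, e, hl, canon_wrapped hI hJ]

lemma run_canon_cons {a b c : Obj} {w : AlphaWord a b} (hw : w.IsWrapped) (d : StdDecomp b c) :
    run 0 (canon (cons w hw d).toAlphaWord.indices (top c.rank)) = none := by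
  obtain ⟨I, J, hI, -, -, e⟩ := exists_canon_cons hw d
  rw [e, run_append, hI.run_canon_nil]
  rfl

/-- A standard decomposition is determined by the orientation of its half diagram. -/
lemma ext_canon {a s s' : Obj} (d : StdDecomp a s) (d' : StdDecomp a s')
    (e : canon d.toAlphaWord.indices (top s.rank) = canon d'.toAlphaWord.indices (top s'.rank)) :
    (⟨s, d⟩ : Σ s, StdDecomp a s) = ⟨s', d'⟩ := by
  induction d generalizing s' with
  | nil a =>
    cases d' with
    | nil => rfl
    | single w hw =>
      exact absurd (OrdList.canon_injective (t := a.rank) (l := []) trivial hw.ordList e).symm hw.1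
    | cons w hw d' =>
      have h := run_canon_cons hw d'
      rw [← e] at h
      exact absurd h (run_replicate_ne_none _ _)
  | single w hw =>
    cases d' with
    | nil =>
      exact absurd (OrdList.canon_injective (l' := []) hw.ordList trivial e) hw.1
    | single w' hw' =>
      cases AlphaWord.ext_indices w w' (OrdList.canon_injective hw.ordList hw'.ordList e)
      rfl
    | cons w' hw' d' =>
      have h := run_canon_cons hw' d'
      rw [← e] at h
      exact absurd h (run_canon_of_isOrdered hw)
  | @cons a b c w hw d ih =>
    cases d' with
    | nil =>
      have h := run_canon_cons hw d
      rw [e] at h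
      exact absurd h (run_replicate_ne_none _ _)
    | single w' hw' =>
      have h := run_canon_cons hw d
      rw [e] at h
      exact absurd h (run_canon_of_isOrdered hw')
    | @cons _ b' _ w' hw' d' =>
      obtain ⟨I, J, hI, hJ, i₁, e₁⟩ := exists_canon_cons hw d
      obtain ⟨I', J', hI', hJ', i₂, e₂⟩ := exists_canon_cons hw' d'
      rw [e₁, e₂] at e
      -- The first descent below 0 separates `I`, and the last ascent never undone separates `J`;
      -- what is left is the rotated state of the rest.
      obtain ⟨eI, f⟩ := append_false_inj hI.run_canon_nil hI'.run_canon_nil e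
      obtain ⟨eJ, g⟩ := append_true_inj hJ.run_canon_nil hJ'.run_canon_nil f
      obtain rfl := hI.canon_nil_injective hI' eI
      obtain rfl := hJ.canon_nil_injective hJ' eJ
      have e' := List.rotate_injective 1 g
      have hr := congrArg List.length e'
      have h₁ := d.toAlphaWord.rank_eq
      have h₂ := d'.toAlphaWord.rank_eq
      simp only [length_canon, List.length_replicate] at hr
      rw [show b.rank = b'.rank by omega] at i₁
      cases AlphaWord.ext_indices w w' (i₁.trans i₂.symm)
      cases ih d' e'
      rfl

end StdDecomp

/-! ### Rewriting index lists into standard ones -/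

/-- Lists of indices of words of Type I on `[m]`. -/
def IndexList : ℕ → List ℕ → Prop
  | _, [] => True
  | m, i :: l => 1 ≤ i ∧ i ≤ 2 * m ∧ IndexList (m - 1) l

/-- The congruence on lists of indices generated by the relations `α_i α_j = α_{j-2} α_i`. -/
inductive IndexEq : ℕ → List ℕ → List ℕ → Prop
  | refl (m : ℕ) (l : List ℕ) : IndexEq m l l
  | symm {m : ℕ} {l l' : List ℕ} (h : IndexEq m l l') : IndexEq m l' l
  | trans {m : ℕ} {l l' l'' : List ℕ} (h : IndexEq m l l') (h' : IndexEq m l' l'') : IndexEq m l l''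
  | cons {m : ℕ} {l l' : List ℕ} (i : ℕ) (h : IndexEq (m - 1) l l') : IndexEq m (i :: l) (i :: l')
  | swap {m : ℕ} (i j : ℕ) (l : List ℕ) (hi : 1 ≤ i) (hij : i + 1 < j) (hj : j ≤ 2 * m)
      (hne : ¬ (i = 1 ∧ j = 2 * m)) : IndexEq m (j :: i :: l) (i :: (j - 2) :: l)

lemma IndexEq.append_right {m : ℕ} {l l' : List ℕ} (h : IndexEq m l l') (r : List ℕ) :
    IndexEq m (l ++ r) (l' ++ r) := by
  induction h with
  | refl m l => exact .refl _ _
  | symm h ih => exact .symm ih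
  | trans h h' ih ih' => exact .trans ih ih'
  | cons i h ih => exact .cons i ih
  | swap i j l hi hij hj hne => exact .swap i j _ hi hij hj hne

lemma IndexEq.append_left {m : ℕ} (r : List ℕ) {l l' : List ℕ} (h : IndexEq (m - r.length) l l') :
    IndexEq m (r ++ l) (r ++ l') := by
  induction r generalizing m with
  | nil => exact h
  | cons i r ih =>
    refine .cons i (ih ?_)
    rwa [Nat.sub_sub, add_comm, ← List.length_cons]

lemma IndexEq.length_eq {m : ℕ} {l l' : List ℕ} (h : IndexEq m l l') : l.length = l'.length := by
  induction h with
  | refl m l => rfl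
  | symm h ih => exact ih.symm
  | trans h h' ih ih' => exact ih.trans ih'
  | cons i h ih => simp [ih]
  | swap i j l hi hij hj hne => simp

lemma indexList_append {m j : ℕ} {l : List ℕ} (h : IndexList m (l ++ [j])) :
    IndexList m l ∧ 1 ≤ j ∧ j ≤ 2 * (m - l.length) := by
  induction l generalizing m with
  | nil => exact ⟨trivial, h.1, h.2.1⟩
  | cons i l ih =>
    obtain ⟨h1, h2, h3⟩ := ih h.2.2
    refine ⟨⟨h.1, h.2.1, h1⟩, h2, ?_⟩
    rwa [List.length_cons, add_comm, ← Nat.sub_sub]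

/-- `J ++ I ++ [2 * n + 2]` is the list of indices of an irreducible word of the second kind
from `[m]` to `[n]`. -/
def WrapList (m n : ℕ) (I J : List ℕ) : Prop :=
  OrdList I.length I ∧ OrdList m J ∧ (∀ j ∈ J, 2 * m + 1 ≤ j + 2 * J.length) ∧
    (J ++ I).Pairwise (· > ·) ∧ m = n + I.length + J.length + 1

/-- Lists of indices of words with a standard decomposition. -/
inductive StdList : ℕ → List ℕ → Prop
  | ord {m : ℕ} {l : List ℕ} (h : OrdList m l) : StdList m l
  | wrap {m n : ℕ} {I J l : List ℕ} (h : WrapList m n I J) (hl : StdList n l) :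
      StdList m (J ++ I ++ [2 * n + 2] ++ l)

/-- A decreasing list fails to be ordered just when some letter is the last index on its source; the
first such letter ends a factor of the second kind with `I` empty. -/
lemma ordList_or_wrapList {m : ℕ} {l : List ℕ} (h : IndexList m l) (hp : l.Pairwise (· > ·)) :
    OrdList m l ∨ ∃ n J r, l = J ++ [2 * n + 2] ++ r ∧ WrapList m n [] J ∧ IndexList n r := by
  induction l generalizing m with
  | nil => exact Or.inl trivial
  | cons i l ih =>
    obtain ⟨h1, h2, h3⟩ := h
    rw [List.pairwise_cons] at hp
    by_cases hi : i = 2 * m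
    · right
      refine ⟨m - 1, [], l, ?_, ⟨trivial, trivial, by simp, by simp, by simp; omega⟩, h3⟩
      rw [show 2 * (m - 1) + 2 = i by omega]
      rfl
    · rcases ih h3 hp.2 with h | ⟨n, J, r, rfl, ⟨-, hJ, hJ', hJp, hm⟩, hr⟩
      · exact Or.inl ⟨h1, by omega, hp.1, h⟩
      · right
        have hn := hp.1 (2 * n + 2) (by simp)
        have hiJ : ∀ j ∈ J, j < i := fun j hj => hp.1 j (by simp [hj])
        simp only [List.length_nil, List.append_nil] at hm hJp
        refine ⟨n, i :: J, r, rfl, ⟨trivial, ⟨h1, by omega, hiJ, hJ⟩, ?_, ?_, ?_⟩, hr⟩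
        · intro j hj
          rw [List.length_cons]
          rcases List.mem_cons.1 hj with rfl | hj
          · omega
          · have := hJ' j hj
            omega
        · rw [List.append_nil]
          exact List.Pairwise.cons hiJ hJp
        · simp only [List.length_nil, List.length_cons]
          omega

lemma stdList_of_pairwise {m : ℕ} {l : List ℕ} (h : IndexList m l) (hp : l.Pairwise (· > ·)) :
    StdList m l := by
  induction hk : l.length using Nat.strong_induction_on generalizing m l with
  | _ k ih =>
    rcases ordList_or_wrapList h hp with h | ⟨n, J, r, rfl, hw, hr⟩
    · exact .ord h
    · have := StdList.wrap hw (ih r.length (by rw [← hk]; simp; omega) hr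
        (List.pairwise_append.1 hp).2.1 rfl)
      simpa using this

/-- The caps of `I` occupy only the first `2 * I.length` points, so a cap further right commutes
with each of them and loses 2 each time. -/
lemma IndexEq.pass {m i : ℕ} {I : List ℕ} (hI : OrdList I.length I) (h₁ : 2 * I.length + 2 ≤ i)
    (h₂ : i + 2 ≤ 2 * m) (r : List ℕ) :
    IndexEq m (i :: I ++ r) (I ++ (i - 2 * I.length) :: r) := by
  induction I generalizing m i with
  | nil => exact .refl _ _
  | cons x I ih =>
    obtain ⟨hx1, hx2, -, hI⟩ := hI
    simp only [List.length_cons, Nat.add_sub_cancel] at hx2 hI h₁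
    refine .trans (.swap x i (I ++ r) hx1 (by omega) (by omega) (by omega)) (.cons x ?_)
    have := ih hI (m := m - 1) (i := i - 2) (by omega) (by omega)
    rwa [Nat.sub_sub, show 2 + 2 * I.length = 2 * (x :: I).length by simp; ring] at this

/-- A cap across the cut after an ordered word sorts its caps into three groups: `I` before its
first foot, `J` after its second foot, and the others, which can be applied after it and form the
decreasing remainder `r`. The last two clauses trace all entries back to `o`, so that they stay
below the next letter in the induction. -/
lemma exists_wrapList {m : ℕ} {o : List ℕ} (ho : OrdList m o) (hlt : o.length < m) :
    ∃ n I J r, IndexEq m (o ++ [2 * (m - o.length)]) (J ++ I ++ [2 * n + 2] ++ r) ∧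
      WrapList m n I J ∧ IndexList n r ∧ r.Pairwise (· > ·) ∧
      (∀ e ∈ r, 2 ≤ e ∧ e + 2 * I.length ∈ o) ∧ (∀ x ∈ J ++ I, x ∈ o) := by
  induction o generalizing m with
  | nil =>
    refine ⟨m - 1, [], [], [], ?_, ⟨trivial, trivial, by simp, by simp, by simp at hlt ⊢; omega⟩,
      trivial, by simp, by simp, by simp⟩
    rw [show 2 * (m - 1) + 2 = 2 * (m - ([] : List ℕ).length) by simp at hlt ⊢; omega]
    exact .refl _ _
  | cons i o ih =>
    obtain ⟨hi1, hi2, hio, ho⟩ := ho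
    simp only [List.length_cons] at hlt
    obtain ⟨n, I, J, r, he, ⟨hI, hJ, hJ', hp, hm⟩, hr, hrp, hre, hmem⟩ := ih ho (by omega)
    rw [Nat.sub_sub, add_comm 1, ← List.length_cons (a := i)] at he
    have he' := IndexEq.cons i he
    have hlt' : ∀ x ∈ J ++ I, x < i := fun x hx => hio x (hmem x hx)
    -- First case: `i` joins `J`. If `J` is empty, this means `i = 2m - 1`, since `i < 2m`.
    by_cases hA : J ≠ [] ∨ 2 * m ≤ i + 1
    · refine ⟨n, I, i :: J, r, he', ⟨hI, ⟨hi1, hi2, fun j hj => hlt' j (by simp [hj]), hJ⟩, ?_,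
        List.Pairwise.cons hlt' hp, by rw [List.length_cons]; omega⟩, hr, hrp,
        fun e h => ⟨(hre e h).1, by simp [(hre e h).2]⟩, ?_⟩
      · intro j hj
        rw [List.length_cons]
        rcases List.mem_cons.1 hj with rfl | hj
        · rcases hA with hA | hA
          · obtain ⟨y, J', rfl⟩ := List.exists_cons_of_ne_nil hA
            have := hJ' y (by simp)
            have := hlt' y (by simp)
            omega
          · omega
        · have := hJ' j hj
          omega
      · intro x hx
        rcases List.mem_cons.1 hx with rfl | hx
        · simp
        · simp [hmem x hx]
    · push Not at hA
      obtain ⟨rfl, hA⟩ := hA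
      simp only [List.nil_append, List.length_nil, add_zero] at he' hlt' hp hm hmem
      -- Second case: `i` joins `I`. An entry of `r` would come from an entry of `o` that is at
      -- least `2 * I.length + 2`, hence above `i`, so `r` is empty.
      by_cases hB : i ≤ 2 * I.length + 1
      · obtain rfl : r = [] := by
          rcases r with _ | ⟨e, r⟩
          · rfl
          · have := hre e (by simp)
            have := hio _ this.2
            omega
        refine ⟨n, i :: I, [], [], he', ⟨⟨hi1, by rw [List.length_cons]; omega, hlt', by simpa using hI⟩,
          trivial, by simp, List.Pairwise.cons hlt' hp,
          by rw [List.length_cons, List.length_nil]; omega⟩, trivial, by simp, by simp, ?_⟩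
        intro x hx
        rcases List.mem_cons.1 hx with rfl | hx
        · simp
        · simp [hmem x hx]
      -- Third case: `i` passes the caps of `I` and then the cap across the cut, whose index rises
      -- from `2n + 2` to `2n + 4`, and becomes the head of `r`.
      · refine ⟨n + 1, I, [], (i - 2 * I.length) :: r, ?_, ⟨hI, trivial, by simp, hp,
          by rw [List.length_nil]; omega⟩, ⟨by omega, by omega, hr⟩,
          List.Pairwise.cons ?_ hrp, ?_, fun x hx => by simp [hmem x hx]⟩
        · have h₁ := IndexEq.pass (m := m) (i := i) hI (by omega) (by omega) ([2 * n + 2] ++ r)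
          have h₂ := IndexEq.append_left (m := m) I (IndexEq.swap (m := m - I.length)
            (i - 2 * I.length) (2 * n + 4) r (by omega) (by omega) (by omega) (by omega)).symm
          refine he'.trans ?_
          have h₃ := h₁.trans h₂
          simpa [mul_add] using h₃
        · intro e h
          have := hio _ (hre e h).2
          omega
        · intro e h
          rcases List.mem_cons.1 h with rfl | h
          · refine ⟨by omega, ?_⟩
            rw [Nat.sub_add_cancel (by omega)]
            simp
          · exact ⟨(hre e h).1, by simp [(hre e h).2]⟩

/-- The new letter moves left, gaining 2 at each step, until it meets a larger letter. The
alternative records whether it reached the head or the head is unchanged, which is what keeps the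
list decreasing at the next step. -/
lemma OrdList.insert {m j : ℕ} {l : List ℕ} (h : OrdList m l) (hj : 1 ≤ j)
    (hj' : j < 2 * (m - l.length)) :
    (OrdList m ((j + 2 * l.length) :: l) ∧ IndexEq m (l ++ [j]) ((j + 2 * l.length) :: l)) ∨
      ∃ x k k', l = x :: k ∧ IndexEq m (l ++ [j]) (x :: k') ∧ OrdList m (x :: k') := by
  induction l generalizing m with
  | nil =>
    left
    simp only [List.length_nil, Nat.sub_zero] at hj'
    exact ⟨⟨by omega, by simpa using hj', by simp, trivial⟩, .refl _ _⟩
  | cons i l ih =>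
    obtain ⟨h1, h2, h3, h4⟩ := h
    simp only [List.length_cons] at hj'
    rcases ih h4 (by omega) with ⟨⟨ho1, ho2, ho3, ho4⟩, he⟩ | ⟨x, k, k', rfl, he, ho⟩
    · by_cases hi : i ≤ j + 2 * l.length
      · left
        simp only [List.length_cons]
        refine ⟨⟨by omega, by omega, ?_, h1, by omega, h3, ho4⟩, ?_⟩
        · intro y hy
          rcases List.mem_cons.1 hy with rfl | hy
          · omega
          · have := h3 y hy
            omega
        · refine (IndexEq.cons i he).trans (.symm ?_)
          have := IndexEq.swap (m := m) i (j + 2 * (l.length + 1)) l h1 (by omega) (by omega)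
            (by omega)
          rwa [show j + 2 * (l.length + 1) - 2 = j + 2 * l.length by omega] at this
      · right
        refine ⟨i, l, _, rfl, IndexEq.cons i he, h1, h2, ?_, ho1, ho2, ho3, ho4⟩
        intro y hy
        rcases List.mem_cons.1 hy with rfl | hy
        · omega
        · exact h3 y hy
    · right
      refine ⟨i, _, _, rfl, IndexEq.cons i he, h1, h2, ?_, ho⟩
      intro y hy
      have hx := h3 x (by simp)
      rcases List.mem_cons.1 hy with rfl | hy
      · exact hx
      · exact (ho.2.2.1 y hy).trans hx

/-- A letter is handed down to the last factor. If it is not the last index there, it is inserted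
into the ordered word; otherwise it closes a factor of the second kind, and the decreasing remainder
is again standard. -/
lemma StdList.append {m j : ℕ} {l : List ℕ} (h : StdList m l) (hj : 1 ≤ j)
    (hj' : j ≤ 2 * (m - l.length)) : ∃ l', IndexEq m (l ++ [j]) l' ∧ StdList m l' := by
  induction h with
  | @ord m l h =>
    by_cases ht : j = 2 * (m - l.length)
    · subst ht
      obtain ⟨n, I, J, r, he, hw, hr, hrp, -⟩ := exists_wrapList h (by omega)
      exact ⟨_, he, .wrap hw (stdList_of_pairwise hr hrp)⟩
    · rcases h.insert hj (by omega) with ⟨ho, he⟩ | ⟨x, k, k', -, he, ho⟩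
      · exact ⟨_, he, .ord ho⟩
      · exact ⟨_, he, .ord ho⟩
  | @wrap m n I J l h hl ih =>
    have hm := h.2.2.2.2
    simp only [List.length_append, List.length_singleton] at hj'
    obtain ⟨l', he, hs⟩ := ih (by omega)
    refine ⟨_, ?_, .wrap h hs⟩
    rw [List.append_assoc (J ++ I ++ [2 * n + 2]) l [j]]
    apply IndexEq.append_left
    simp only [List.length_append, List.length_singleton]
    rwa [show m - (J.length + I.length + 1) = n by omega]

lemma exists_stdList {m : ℕ} {l : List ℕ} (h : IndexList m l) :
    ∃ l', IndexEq m l l' ∧ StdList m l' := by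
  induction l using List.reverseRecOn with
  | nil => exact ⟨[], .refl _ _, .ord trivial⟩
  | append_singleton l j ih =>
    obtain ⟨h1, h2, h3⟩ := indexList_append h
    obtain ⟨l₁, he, hs⟩ := ih h1
    obtain ⟨l₂, he', hs'⟩ := hs.append h2 (by rwa [← he.length_eq])
    exact ⟨l₂, (he.append_right _).trans he', hs'⟩

/-! ### Every morphism is a composite of Types III, II, I and loops -/

lemma Word.eval_after {a b c : Obj} (v : Word b c) (w : Word a b) :
    (v ⊚ w).eval = w.eval ≫ v.eval :=
  (CategoryTheory.Quotient.functor homRel).map_comp (X := a) (Y := b) (Z := c) w v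

lemma Word.eval_nil (a : Obj) : Word.eval (Quiver.Path.nil : Word a a) = 𝟙 (ADelta.obj a) :=
  (CategoryTheory.Quotient.functor homRel).map_id a

lemma Word.eval_cons {a b c : Obj} (w : Word a b) (g : Gen b c) :
    Word.eval (Quiver.Path.cons w g) = w.eval ≫ g.word.eval :=
  Word.eval_after g.word w

lemma Rel.eval_eq {a b : Obj} {v w : Word a b} (h : Rel v w) : v.eval = w.eval :=
  @CategoryTheory.Quotient.sound (Paths Obj) _ homRel a b v w h

lemma exists_eval_eq {a b : Obj} (f : ADelta.obj a ⟶ ADelta.obj b) : ∃ w : Word a b, w.eval = f :=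
  ⟨Quot.out f, Quot.out_eq f⟩

/-- The morphism `α_i`. -/
abbrev capMor {a b : Obj} {i : ℕ} (h : IsAlpha a i b) : ADelta.obj a ⟶ ADelta.obj b :=
  (Gen.alpha i h).word.eval

/-- The morphism `β_i`. -/
abbrev cupMor {a b : Obj} {i : ℕ} (h : IsAlpha a i b) : ADelta.obj b ⟶ ADelta.obj a :=
  (Gen.beta i h).word.eval

/-- The morphism `τ^s`. -/
abbrev rotMor (n s : ℕ) : ADelta.obj (.succ n) ⟶ ADelta.obj (.succ n) := ((Gen.tau n).pow s).eval

lemma Gen.eval_pow_add {a : Obj} (g : Gen a a) (s s' : ℕ) :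
    (g.pow s).eval ≫ (g.pow s').eval = (g.pow (s + s')).eval := by
  induction s' with
  | zero => rw [Gen.pow, Word.eval_nil, Category.comp_id]; rfl
  | succ s' ih => rw [← add_assoc, Gen.pow, Gen.pow, Word.eval_cons, Word.eval_cons,
      ← Category.assoc, ih]

lemma rotMor_self (n : ℕ) : rotMor n (n + 1) = 𝟙 _ :=
  (Rel.tau_pow n).eval_eq.trans (Word.eval_nil _)

lemma rotMor_mod (n s : ℕ) : rotMor n (s % (n + 1)) = rotMor n s := by
  have h : ∀ k, rotMor n ((n + 1) * k) = 𝟙 _ := by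
    intro k
    induction k with
    | zero => exact Word.eval_nil _
    | succ k ih =>
      rw [mul_add, mul_one]
      exact (Gen.eval_pow_add _ _ _).symm.trans (by
        change rotMor n _ ≫ rotMor n _ = _
        rw [ih, rotMor_self, Category.comp_id])
  conv_rhs => rw [← Nat.mod_add_div s (n + 1)]
  change _ = ((Gen.tau n).pow _).eval
  rw [← Gen.eval_pow_add]
  change _ = rotMor n _ ≫ rotMor n _
  rw [h, Category.comp_id]

/-- The morphism `δ_+^c δ_-^d`. -/
def loopMor (a : Obj) (c d : ℕ) : ADelta.obj a ⟶ ADelta.obj a :=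
  ((Gen.deltaMinus a).pow d).eval ≫ ((Gen.deltaPlus a).pow c).eval

lemma eval_comm_of_gen (δ : ∀ a, Gen a a)
    (h : ∀ {a b : Obj} (g : Gen a b), (δ a).word.eval ≫ g.word.eval = g.word.eval ≫ (δ b).word.eval)
    {a b : Obj} (f : ADelta.obj a ⟶ ADelta.obj b) (c : ℕ) :
    ((δ a).pow c).eval ≫ f = f ≫ ((δ b).pow c).eval := by
  have h₁ : (δ a).word.eval ≫ f = f ≫ (δ b).word.eval := by
    obtain ⟨w, rfl⟩ := exists_eval_eq f
    induction w with
    | nil => rw [Word.eval_nil, Category.comp_id, Category.id_comp]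
    | cons w g ih => rw [Word.eval_cons, ← Category.assoc, ih, Category.assoc, h, Category.assoc]
  induction c with
  | zero => simp only [Gen.pow, Word.eval_nil, Category.comp_id, Category.id_comp]
  | succ c ih =>
    simp only [Gen.pow, Word.eval_cons, Category.assoc]
    rw [h₁, ← Category.assoc, ih, Category.assoc]

lemma deltaPlus_comm {a b : Obj} (f : ADelta.obj a ⟶ ADelta.obj b) (c : ℕ) :
    ((Gen.deltaPlus a).pow c).eval ≫ f = f ≫ ((Gen.deltaPlus b).pow c).eval :=
  eval_comm_of_gen Gen.deltaPlus (fun g => by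
    rw [← Word.eval_after, ← Word.eval_after, (Rel.deltaPlus_comm g).eval_eq]) f c

lemma deltaMinus_comm {a b : Obj} (f : ADelta.obj a ⟶ ADelta.obj b) (c : ℕ) :
    ((Gen.deltaMinus a).pow c).eval ≫ f = f ≫ ((Gen.deltaMinus b).pow c).eval :=
  eval_comm_of_gen Gen.deltaMinus (fun g => by
    rw [← Word.eval_after, ← Word.eval_after, (Rel.deltaMinus_comm g).eval_eq]) f c

lemma loopMor_comm {a b : Obj} (f : ADelta.obj a ⟶ ADelta.obj b) (c d : ℕ) :
    loopMor a c d ≫ f = f ≫ loopMor b c d := by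
  rw [loopMor, Category.assoc, deltaPlus_comm, ← Category.assoc, deltaMinus_comm, Category.assoc]
  rfl

lemma loopMor_comm_assoc {a b c : Obj} (f : ADelta.obj a ⟶ ADelta.obj b) (k l : ℕ)
    (g : ADelta.obj b ⟶ ADelta.obj c) : loopMor a k l ≫ f ≫ g = f ≫ loopMor b k l ≫ g := by
  rw [← Category.assoc, loopMor_comm, Category.assoc]

lemma loopMor_zero (a : Obj) : loopMor a 0 0 = 𝟙 _ := by
  simp only [loopMor, Gen.pow, Word.eval_nil, Category.comp_id]

lemma loopMor_add (a : Obj) (c d c' d' : ℕ) :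
    loopMor a c d ≫ loopMor a c' d' = loopMor a (c + c') (d + d') := by
  rw [loopMor, Category.assoc, ← loopMor_comm, loopMor, Category.assoc, Gen.eval_pow_add,
    ← Category.assoc, Gen.eval_pow_add, add_comm d, add_comm c, add_comm d', add_comm c', loopMor,
    add_comm d, add_comm c]

lemma IsTypeII.comp {a b c : Obj} {f : ADelta.obj a ⟶ ADelta.obj b}
    {g : ADelta.obj b ⟶ ADelta.obj c} (hf : IsTypeII f) (hg : IsTypeII g) : IsTypeII (f ≫ g) := by
  obtain ⟨w, rfl⟩ := hf
  obtain ⟨v, rfl⟩ := hg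
  induction v with
  | tauPow n s =>
    cases w with
    | tauPow _ s' => exact ⟨.tauPow n (s' + s), (Gen.eval_pow_add _ _ _).symm⟩
  | idPlus => exact ⟨w, by simp only [RotWord.toWord, Word.eval_nil, Category.comp_id]⟩
  | idMinus => exact ⟨w, by simp only [RotWord.toWord, Word.eval_nil, Category.comp_id]⟩
  | sigmaPlus v ih =>
    obtain ⟨u, hu⟩ := ih w
    exact ⟨.sigmaPlus u, by simp only [RotWord.toWord, Word.eval_after, hu, Category.assoc]⟩
  | sigmaMinus v ih =>
    obtain ⟨u, hu⟩ := ih w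
    exact ⟨.sigmaMinus u, by simp only [RotWord.toWord, Word.eval_after, hu, Category.assoc]⟩

lemma isTypeII_rotMor (n s : ℕ) : IsTypeII (rotMor n s) := ⟨.tauPow n s, rfl⟩

lemma isTypeII_id (a : Obj) : IsTypeII (𝟙 (ADelta.obj a)) := by
  cases a
  · exact ⟨.idPlus, Word.eval_nil _⟩
  · exact ⟨.idMinus, Word.eval_nil _⟩
  · exact ⟨.tauPow _ 0, Word.eval_nil _⟩

lemma RotWord.eq_of_succ {n : ℕ} {b : Obj} (w : RotWord (.succ n) b) : b = .succ n := by
  have := w.rank_eq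
  cases b <;> simp_all [Obj.rank]

lemma IsTypeII.eq_rotMor {n : ℕ} {f : ADelta.obj (.succ n) ⟶ ADelta.obj (.succ n)}
    (h : IsTypeII f) : ∃ s, f = rotMor n s := by
  obtain ⟨w, rfl⟩ := h
  cases w with
  | tauPow _ s => exact ⟨s, rfl⟩

lemma rotMor_zero_eq (s : ℕ) : rotMor 0 s = 𝟙 _ := by
  rw [← rotMor_mod, Nat.mod_one]; exact Word.eval_nil _

lemma rotMor_comp (n s s' : ℕ) : rotMor n s ≫ rotMor n s' = rotMor n (s + s') :=
  Gen.eval_pow_add _ _ _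

lemma rotMor_capMor (m i k : ℕ) (h : IsAlpha (.succ (m + 1)) i (.succ m))
    (h' : IsAlpha (.succ (m + 1)) (i + 2 * k) (.succ m)) :
    rotMor (m + 1) k ≫ capMor h' = capMor h ≫ rotMor m k := by
  induction k with
  | zero =>
    change ((Gen.tau _).pow 0).eval ≫ _ = _ ≫ ((Gen.tau _).pow 0).eval
    simp only [Gen.pow, Word.eval_nil, Category.comp_id, Category.id_comp]
    rfl
  | succ k ih =>
    have hle := h'.le
    have h1 := h.one_le
    have h₂ : IsAlpha (.succ (m + 1)) (i + 2 * k) (.succ m) :=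
      .step _ _ (by omega) (by simp only [Obj.rank] at hle; omega)
    have : rotMor (m + 1) 1 ≫ capMor h' = capMor h₂ ≫ rotMor m 1 := by
      have := (Rel.alpha_tau (m + 1) m (i + 2 * (k + 1)) (by omega) h' h₂).eval_eq
      rwa [Word.eval_after, Word.eval_after] at this
    rw [← rotMor_comp, ← rotMor_comp, Category.assoc, this,
      ← Category.assoc, ← Category.assoc, ih h₂]

lemma cupMor_rotMor (m i k : ℕ) (h : IsAlpha (.succ (m + 1)) i (.succ m))
    (h' : IsAlpha (.succ (m + 1)) (i + 2 * k) (.succ m)) :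
    cupMor h ≫ rotMor (m + 1) k = rotMor m k ≫ cupMor h' := by
  induction k with
  | zero =>
    change _ ≫ ((Gen.tau _).pow 0).eval = ((Gen.tau _).pow 0).eval ≫ _
    simp only [Gen.pow, Word.eval_nil, Category.comp_id, Category.id_comp]
    rfl
  | succ k ih =>
    have hle := h'.le
    have h1 := h.one_le
    have h₂ : IsAlpha (.succ (m + 1)) (i + 2 * k) (.succ m) :=
      .step _ _ (by omega) (by simp only [Obj.rank] at hle; omega)
    have : rotMor m 1 ≫ cupMor h' = cupMor h₂ ≫ rotMor (m + 1) 1 := by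
      have := (Rel.beta_tau m (m + 1) (i + 2 * (k + 1)) (by omega) h' h₂).eval_eq
      rwa [Word.eval_after, Word.eval_after] at this
    rw [← rotMor_comp, ← rotMor_comp, Category.assoc, this,
      ← Category.assoc, ← Category.assoc, ih h₂]

lemma exists_rotMor_one_capMor {n i : ℕ} {b : Obj} (h : IsAlpha (.succ n) i b) :
    ∃ (i' : ℕ) (h' : IsAlpha (.succ n) i' b) (r : ADelta.obj b ⟶ ADelta.obj b),
      IsTypeII r ∧ rotMor n 1 ≫ capMor h = capMor h' ≫ r := by
  cases h with
  | toPlus => exact ⟨_, .toPlus, _, isTypeII_id _, by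
      rw [rotMor_zero_eq, Category.comp_id, Category.id_comp]⟩
  | toMinus => exact ⟨_, .toMinus, _, isTypeII_id _, by
      rw [rotMor_zero_eq, Category.comp_id, Category.id_comp]⟩
  | step m i h₁ h₂ =>
    by_cases hi : 3 ≤ i
    · obtain ⟨j, rfl⟩ := Nat.exists_eq_add_of_le' (show 2 ≤ i by omega)
      exact ⟨j, .step _ _ (by omega) (by omega), _, isTypeII_rotMor m 1,
        rotMor_capMor m j 1 _ (.step m (j + 2) h₁ h₂)⟩
    -- For `i ≤ 2` the relation is not available directly. Going once around, `τ^(m+1)` turns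
    -- `α_{i+2(m+1)}` into `α_i`, and `τ^(m+2) = id` on the source.
    · have h' : IsAlpha (.succ (m + 1)) (i + 2 * (m + 1)) (.succ m) :=
        .step _ _ (by omega) (by omega)
      refine ⟨_, h', _, isTypeII_id _, ?_⟩
      have := rotMor_capMor m i (m + 1) (.step m i h₁ h₂) h'
      rw [rotMor_self, Category.comp_id] at this
      rw [← this, ← Category.assoc, rotMor_comp, show 1 + (m + 1) = m + 1 + 1 from add_comm _ _,
        rotMor_self, Category.id_comp, Category.comp_id]

lemma exists_cupMor_rotMor_one {n i : ℕ} {b : Obj} (h : IsAlpha (.succ n) i b) :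
    ∃ (i' : ℕ) (h' : IsAlpha (.succ n) i' b) (r : ADelta.obj b ⟶ ADelta.obj b),
      IsTypeII r ∧ cupMor h ≫ rotMor n 1 = r ≫ cupMor h' := by
  cases h with
  | toPlus => exact ⟨_, .toPlus, _, isTypeII_id _, by
      rw [rotMor_zero_eq, Category.comp_id, Category.id_comp]⟩
  | toMinus => exact ⟨_, .toMinus, _, isTypeII_id _, by
      rw [rotMor_zero_eq, Category.comp_id, Category.id_comp]⟩
  | step m i h₁ h₂ =>
    by_cases hi : i + 2 ≤ 2 * (m + 2)
    · have h' : IsAlpha (.succ (m + 1)) (i + 2 * 1) (.succ m) := .step _ _ (by omega) (by omega)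
      exact ⟨_, h', _, isTypeII_rotMor m 1, cupMor_rotMor m i 1 (.step m i h₁ h₂) h'⟩
    · obtain ⟨j, rfl⟩ := Nat.exists_eq_add_of_le' (show 2 * (m + 1) ≤ i by omega)
      have h' : IsAlpha (.succ (m + 1)) j (.succ m) := .step _ _ (by omega) (by omega)
      refine ⟨_, h', _, isTypeII_id _, ?_⟩
      have := cupMor_rotMor m j (m + 1) h' (.step m _ h₁ h₂)
      rw [rotMor_self, Category.id_comp] at this
      rw [← this, Category.assoc, rotMor_comp, rotMor_self, Category.id_comp, Category.comp_id]

lemma exists_rotMor_capMor {n i : ℕ} {b : Obj} (h : IsAlpha (.succ n) i b) (s : ℕ) :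
    ∃ (i' : ℕ) (h' : IsAlpha (.succ n) i' b) (r : ADelta.obj b ⟶ ADelta.obj b),
      IsTypeII r ∧ rotMor n s ≫ capMor h = capMor h' ≫ r := by
  induction s generalizing i with
  | zero => exact ⟨i, h, _, isTypeII_id _, by
      change ((Gen.tau _).pow 0).eval ≫ _ = _
      rw [Gen.pow, Word.eval_nil, Category.comp_id, Category.id_comp]⟩
  | succ s ih =>
    obtain ⟨i₁, h₁, r₁, hr₁, e₁⟩ := exists_rotMor_one_capMor h
    obtain ⟨i₂, h₂, r₂, hr₂, e₂⟩ := ih h₁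
    refine ⟨i₂, h₂, _, hr₂.comp hr₁, ?_⟩
    rw [← rotMor_comp, Category.assoc, e₁, ← Category.assoc, e₂, Category.assoc]

lemma exists_cupMor_comp {a b : Obj} {i : ℕ} (h : IsAlpha a i b)
    {r : ADelta.obj a ⟶ ADelta.obj a} (hr : IsTypeII r) :
    ∃ (i' : ℕ) (h' : IsAlpha a i' b) (r' : ADelta.obj b ⟶ ADelta.obj b),
      IsTypeII r' ∧ cupMor h ≫ r = r' ≫ cupMor h' := by
  obtain ⟨n, rfl⟩ : ∃ n, a = .succ n := by cases h <;> exact ⟨_, rfl⟩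
  obtain ⟨s, rfl⟩ := hr.eq_rotMor
  clear hr
  induction s with
  | zero => exact ⟨i, h, _, isTypeII_id _, by
      change _ ≫ ((Gen.tau _).pow 0).eval = _
      rw [Gen.pow, Word.eval_nil, Category.comp_id, Category.id_comp]⟩
  | succ s ih =>
    obtain ⟨i₁, h₁, r₁, hr₁, e₁⟩ := ih
    obtain ⟨i₂, h₂, r₂, hr₂, e₂⟩ := exists_cupMor_rotMor_one h₁
    refine ⟨i₂, h₂, _, hr₁.comp hr₂, ?_⟩
    rw [← rotMor_comp, ← Category.assoc, e₁, Category.assoc, e₂, Category.assoc]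

namespace AlphaWord

lemma toWord_after {a b : Obj} (w : AlphaWord a b) : ∀ {c : Obj} (v : AlphaWord b c),
    (v.after w).toWord.eval = w.toWord.eval ≫ v.toWord.eval
  | _, nil _ => by simp only [after, toWord, Word.eval_nil, Category.comp_id]
  | _, snoc v i h => by
    simp only [after, toWord, Word.eval_after, toWord_after w v, Category.assoc]

lemma star_after {a b : Obj} (w : AlphaWord a b) : ∀ {c : Obj} (v : AlphaWord b c),
    (v.after w).star.eval = v.star.eval ≫ w.star.eval
  | _, nil _ => by simp only [after, star, Word.eval_nil, Category.id_comp]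
  | _, snoc v i h => by
    simp only [after, star, Word.eval_after, star_after w v, Category.assoc]

lemma eval_toWord_snoc {a b c : Obj} (w : AlphaWord a b) (i : ℕ) (h : IsAlpha b i c) :
    (snoc w i h).toWord.eval = w.toWord.eval ≫ capMor h := Word.eval_after _ _

lemma eval_star_snoc {a b c : Obj} (w : AlphaWord a b) (i : ℕ) (h : IsAlpha b i c) :
    (snoc w i h).star.eval = cupMor h ≫ w.star.eval := Word.eval_after _ _

lemma exists_star_comp {b t : Obj} (w : AlphaWord b t) {r : ADelta.obj b ⟶ ADelta.obj b}
    (hr : IsTypeII r) : ∃ (w' : AlphaWord b t) (r' : ADelta.obj t ⟶ ADelta.obj t),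
      IsTypeII r' ∧ w.star.eval ≫ r = r' ≫ w'.star.eval := by
  induction w with
  | nil => exact ⟨nil b, r, hr, by simp only [star, Word.eval_nil, Category.id_comp,
      Category.comp_id]⟩
  | snoc w i h ih =>
    obtain ⟨w₁, r₁, hr₁, e₁⟩ := ih
    obtain ⟨i₂, h₂, r₂, hr₂, e₂⟩ := exists_cupMor_comp h hr₁
    refine ⟨snoc w₁ i₂ h₂, r₂, hr₂, ?_⟩
    rw [eval_star_snoc, eval_star_snoc, Category.assoc, e₁, ← Category.assoc, e₂, Category.assoc]

end AlphaWord

/-- Type II morphisms up to closed loops. -/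
def IsLoopRot {a b : Obj} (f : ADelta.obj a ⟶ ADelta.obj b) : Prop :=
  ∃ c d r, IsTypeII r ∧ f = loopMor a c d ≫ r

lemma IsTypeII.isLoopRot {a b : Obj} {f : ADelta.obj a ⟶ ADelta.obj b} (h : IsTypeII f) :
    IsLoopRot f := ⟨0, 0, f, h, by rw [loopMor_zero, Category.id_comp]⟩

lemma isLoopRot_deltaPlus (a : Obj) : IsLoopRot (Gen.deltaPlus a).word.eval :=
  ⟨1, 0, _, isTypeII_id a, by
    simp only [loopMor, Gen.pow, Word.eval_nil, Category.id_comp, Category.comp_id]; rfl⟩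

lemma isLoopRot_deltaMinus (a : Obj) : IsLoopRot (Gen.deltaMinus a).word.eval :=
  ⟨0, 1, _, isTypeII_id a, by
    simp only [loopMor, Gen.pow, Word.eval_nil, Category.comp_id]; rfl⟩

lemma exists_isAlpha_isAlpha {n i j : ℕ} (hi : 1 ≤ i) (hij : i ≤ j) (hj : j ≤ 2 * (n + 1))
    (hne : ¬ (i = 1 ∧ j = 2 * (n + 1))) :
    ∃ c, IsAlpha (.succ n) i c ∧ IsAlpha (.succ n) j c := by
  rcases n with _ | n
  · obtain ⟨rfl, rfl⟩ | ⟨rfl, rfl⟩ : i = 1 ∧ j = 1 ∨ i = 2 ∧ j = 2 := by omega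
    · exact ⟨_, .toPlus, .toPlus⟩
    · exact ⟨_, .toMinus, .toMinus⟩
  · exact ⟨_, .step _ _ (by omega) (by omega), .step _ _ (by omega) (by omega)⟩

/-- A cup followed by a cap either merges into a loop, an identity, a power of `τ` or a letter
`σ_±`, or the two trade places. -/
lemma cupMor_capMor {c t t' : Obj} {i j : ℕ} (hj : IsAlpha c j t) (hi : IsAlpha c i t') :
    IsLoopRot (cupMor hj ≫ capMor hi) ∨
      ∃ (e : Obj) (i' j' : ℕ) (hi' : IsAlpha t i' e) (hj' : IsAlpha t' j' e),
        cupMor hj ≫ capMor hi = capMor hi' ≫ cupMor hj' := by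
  have self : ∀ {i : ℕ} {t : Obj} (hi : IsAlpha c i t), IsLoopRot (cupMor hi ≫ capMor hi) := by
    intro i t hi
    rw [← Word.eval_after]
    rcases Nat.even_or_odd i with h | h
    · rw [(Rel.alpha_beta_even i h hi).eval_eq]; exact isLoopRot_deltaMinus _
    · rw [(Rel.alpha_beta_odd i h hi).eval_eq]; exact isLoopRot_deltaPlus _
  cases hj with
  | toPlus =>
    left
    cases hi with
    | toPlus => exact self _
    | toMinus =>
      refine IsTypeII.isLoopRot ⟨.sigmaPlus .idPlus, ?_⟩
      simp only [RotWord.toWord, Word.eval_after, Word.eval_nil, Category.id_comp]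
  | toMinus =>
    left
    cases hi with
    | toMinus => exact self _
    | toPlus =>
      refine IsTypeII.isLoopRot ⟨.sigmaMinus .idMinus, ?_⟩
      simp only [RotWord.toWord, Word.eval_after, Word.eval_nil, Category.id_comp]
  | step n j h₁ h₂ =>
    cases hi with
    | step _ i h₃ h₄ =>
      have hj : IsAlpha (.succ (n + 1)) j (.succ n) := .step n j h₁ h₂
      have hi : IsAlpha (.succ (n + 1)) i (.succ n) := .step n i h₃ h₄
      simp only [← Word.eval_after]
      rcases lt_trichotomy i j with hlt | rfl | hlt
      · by_cases hs : j = i + 1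
        · subst hs
          rw [(Rel.alpha_beta_succ n i hj hi).eval_eq, Word.eval_nil]
          exact Or.inl (isTypeII_id _).isLoopRot
        · by_cases hne : i = 1 ∧ j = 2 * (n + 1) + 2
          · obtain ⟨rfl, rfl⟩ := hne
            rw [(Rel.alpha_beta_first_last n hi hj).eval_eq]
            exact Or.inl (isTypeII_rotMor n n).isLoopRot
          · obtain ⟨e, hi', hj'⟩ := exists_isAlpha_isAlpha (n := n) (i := i) (j := j - 2) h₃
              (by omega) (by omega) (by omega)
            right
            refine ⟨e, i, j - 2, hi', hj', ?_⟩
            rw [(Rel.alpha_beta_lt n i j (by omega) (by simpa using hne) hj hi hi' hj').eval_eq]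
      · rw [Word.eval_after]
        exact Or.inl (self _)
      · by_cases hs : i = j + 1
        · subst hs
          rw [(Rel.alpha_succ_beta n j hj hi).eval_eq, Word.eval_nil]
          exact Or.inl (isTypeII_id _).isLoopRot
        · by_cases hne : i = 2 * (n + 1) + 2 ∧ j = 1
          · obtain ⟨rfl, rfl⟩ := hne
            rw [(Rel.alpha_beta_last_first n hj hi).eval_eq]
            exact Or.inl (isTypeII_rotMor n 1).isLoopRot
          · obtain ⟨e, hj', hi'⟩ := exists_isAlpha_isAlpha (n := n) (i := j) (j := i - 2) h₁
              (by omega) (by omega) (by omega)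
            right
            refine ⟨e, i - 2, j, hi', hj', ?_⟩
            rw [(Rel.alpha_beta_gt n i j (by omega) (by simpa using hne) hj hi hi' hj').eval_eq]

/-- The cap travels through the cups until one of them absorbs it; the resulting rotation then
continues past the remaining cups. -/
lemma AlphaWord.exists_star_capMor {b t b' : Obj} (w : AlphaWord b t) {i : ℕ}
    (h : IsAlpha b i b') :
    ∃ (t' : Obj) (w' : AlphaWord b' t') (x : ADelta.obj t ⟶ ADelta.obj t'),
      (IsLoopRot x ∨ ∃ (i' : ℕ) (h' : IsAlpha t i' t'), x = capMor h') ∧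
        w.star.eval ≫ capMor h = x ≫ w'.star.eval := by
  induction w with
  | nil => exact ⟨b', nil b', _, Or.inr ⟨i, h, rfl⟩, by
      simp only [star, Word.eval_nil, Category.id_comp, Category.comp_id]⟩
  | @snoc c t w j hj ih =>
    obtain ⟨t', w', x, hx, e⟩ := ih
    rcases hx with ⟨k, l, r, hr, rfl⟩ | ⟨i', h', rfl⟩
    · obtain ⟨n, rfl⟩ : ∃ n, c = .succ n := by cases hj <;> exact ⟨_, rfl⟩
      obtain rfl : t' = .succ n := by obtain ⟨v, -⟩ := hr; exact v.eq_of_succ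
      obtain ⟨j₂, h₂, r₂, hr₂, e₂⟩ := exists_cupMor_comp hj hr
      refine ⟨t, snoc w' j₂ h₂, loopMor t k l ≫ r₂, Or.inl ⟨k, l, r₂, hr₂, rfl⟩, ?_⟩
      rw [eval_star_snoc, eval_star_snoc, Category.assoc, e, Category.assoc, ← Category.assoc,
        ← loopMor_comm, Category.assoc, Category.assoc, ← Category.assoc (cupMor hj), e₂,
        Category.assoc]
    · rcases cupMor_capMor hj h' with hx | ⟨e', i₂, j₂, hi₂, hj₂, e₂⟩
      · exact ⟨t', w', _, Or.inl hx, by rw [eval_star_snoc, Category.assoc, e, Category.assoc]⟩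
      · refine ⟨e', snoc w' j₂ hj₂, _, Or.inr ⟨i₂, hi₂, rfl⟩, ?_⟩
        rw [eval_star_snoc, eval_star_snoc, Category.assoc, e, ← Category.assoc, e₂,
          Category.assoc]

lemma TypeDecomp.eval_eq {a b : Obj} (d : TypeDecomp a b) :
    d.eval = d.one ≫ d.two ≫ d.three ≫ loopMor b d.cPlus d.cMinus := rfl

/-- A cup joins `f_III`, while rotations and loops pass through the cups into the middle. A cap is
either absorbed on the way or reaches `f_II`, and then passes it to join `f_I`. -/
lemma TypeDecomp.exists_comp_gen {a b b' : Obj} (d : TypeDecomp a b) (g : Gen b b') :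
    ∃ d' : TypeDecomp a b', d'.eval = d.eval ≫ g.word.eval := by
  obtain ⟨c, k, s, t, one, two, three, ⟨w₁, rfl⟩, h₂, ⟨w₃, rfl⟩⟩ := d
  have comm : ∀ x : ADelta.obj b ⟶ ADelta.obj b',
      TypeDecomp.eval ⟨c, k, s, t, w₁.toWord.eval, two, w₃.star.eval, ⟨w₁, rfl⟩, h₂, ⟨w₃, rfl⟩⟩ ≫ x =
        w₁.toWord.eval ≫ two ≫ (w₃.star.eval ≫ x) ≫ loopMor b' c k := by
    intro x
    simp only [TypeDecomp.eval_eq, Category.assoc, loopMor_comm]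
  have push : ∀ (x : ADelta.obj b ⟶ ADelta.obj b') {t' : Obj} (r : ADelta.obj t ⟶ ADelta.obj t')
      (w : AlphaWord b' t'), IsLoopRot r → w₃.star.eval ≫ x = r ≫ w.star.eval →
      ∃ d' : TypeDecomp a b', d'.eval = TypeDecomp.eval
        ⟨c, k, s, t, w₁.toWord.eval, two, w₃.star.eval, ⟨w₁, rfl⟩, h₂, ⟨w₃, rfl⟩⟩ ≫ x := by
    rintro x t' _ w ⟨c', k', r, hr, rfl⟩ e
    refine ⟨⟨c' + c, k' + k, s, t', w₁.toWord.eval, two ≫ r, w.star.eval, ⟨w₁, rfl⟩, h₂.comp hr,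
      ⟨w, rfl⟩⟩, ?_⟩
    rw [comm, e]
    simp only [TypeDecomp.eval_eq, Category.assoc, ← loopMor_add]
    rw [loopMor_comm_assoc, loopMor_comm_assoc]
  cases g with
  | alpha i h =>
    obtain ⟨t', w', x, hx | ⟨i', h', rfl⟩, e⟩ := w₃.exists_star_capMor h
    · exact push _ x w' hx e
    -- No cap starts at `[0±]`, so here the middle factor is a power of `τ`, past which a cap can
    -- move.
    · obtain ⟨n, rfl⟩ : ∃ n, t = .succ n := by cases h' <;> exact ⟨_, rfl⟩
      obtain rfl : s = .succ n := by
        obtain ⟨v, -⟩ := h₂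
        have := v.rank_eq
        cases s <;> simp_all [Obj.rank]
      obtain ⟨q, rfl⟩ := h₂.eq_rotMor
      obtain ⟨i₂, hi₂, r, hr, e₂⟩ := exists_rotMor_capMor h' q
      refine ⟨⟨c, k, t', t', (AlphaWord.snoc w₁ i₂ hi₂).toWord.eval, r, w'.star.eval, ⟨_, rfl⟩, hr,
        ⟨_, rfl⟩⟩, ?_⟩
      rw [comm, e]
      change (AlphaWord.snoc w₁ i₂ hi₂).toWord.eval ≫ r ≫ w'.star.eval ≫ loopMor b' c k = _
      rw [AlphaWord.eval_toWord_snoc]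
      simp only [Category.assoc]
      rw [← Category.assoc (rotMor n q), e₂]
      simp only [Category.assoc]
  | beta i h =>
    refine ⟨⟨c, k, s, t, w₁.toWord.eval, two,
      (w₃.after (.snoc (.nil _) i h)).star.eval, ⟨_, rfl⟩, h₂, ⟨_, rfl⟩⟩, ?_⟩
    rw [comm]
    change w₁.toWord.eval ≫ two ≫ (w₃.after (.snoc (.nil _) i h)).star.eval ≫ loopMor b' c k = _
    rw [AlphaWord.star_after, AlphaWord.eval_star_snoc]
    simp only [AlphaWord.star, Word.eval_nil, Category.comp_id]
  | tau n =>
    obtain ⟨w', r, hr, e⟩ := w₃.exists_star_comp (isTypeII_rotMor n 1)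
    exact push _ r w' hr.isLoopRot e
  | deltaPlus =>
    refine push _ _ w₃ (isLoopRot_deltaPlus t) ?_
    have := deltaPlus_comm w₃.star.eval 1
    simp only [Gen.pow] at this
    exact this.symm
  | deltaMinus =>
    refine push _ _ w₃ (isLoopRot_deltaMinus t) ?_
    have := deltaMinus_comm w₃.star.eval 1
    simp only [Gen.pow] at this
    exact this.symm

lemma exists_typeDecomp {a b : Obj} (f : ADelta.obj a ⟶ ADelta.obj b) :
    ∃ d : TypeDecomp a b, d.eval = f := by
  obtain ⟨w, rfl⟩ := exists_eval_eq f
  induction w with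
  | nil =>
    refine ⟨⟨0, 0, a, a, 𝟙 _, 𝟙 _, 𝟙 _, ⟨.nil a, Word.eval_nil _⟩, isTypeII_id a,
      ⟨.nil a, Word.eval_nil _⟩⟩, ?_⟩
    simp only [TypeDecomp.eval_eq, loopMor_zero, Word.eval_nil, Category.comp_id]
  | cons w g ih =>
    obtain ⟨d, hd⟩ := ih
    obtain ⟨d', hd'⟩ := d.exists_comp_gen g
    exact ⟨d', by rw [hd', hd, Word.eval_cons]⟩

/-! ### From index lists back to words and standard forms -/

namespace AlphaWord

lemma exists_after {a b : Obj} (w : AlphaWord a b) {l₁ l₂ : List ℕ} (h : w.indices = l₁ ++ l₂) :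
    ∃ (c : Obj) (w₁ : AlphaWord a c) (w₂ : AlphaWord c b),
      w = w₂.after w₁ ∧ w₁.indices = l₁ ∧ w₂.indices = l₂ := by
  induction w generalizing l₂ with
  | nil =>
    obtain ⟨rfl, rfl⟩ := List.append_eq_nil_iff.1 h.symm
    exact ⟨a, nil a, nil a, rfl, rfl, rfl⟩
  | @snoc c b w i hi ih =>
    rcases List.eq_nil_or_concat l₂ with rfl | ⟨l, k, rfl⟩
    · exact ⟨b, snoc w i hi, nil b, rfl, by simpa using h, rfl⟩
    · rw [indices, List.concat_eq_append, ← List.append_assoc] at h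
      obtain ⟨h₁, h₂⟩ := List.append_inj' h rfl
      obtain rfl : i = k := by simpa using h₂
      obtain ⟨e, w₁, w₂, rfl, e₁, e₂⟩ := ih h₁
      exact ⟨e, w₁, snoc w₂ i hi, rfl, e₁, by simp [indices, e₂]⟩

lemma exists_after_cons {a b : Obj} (w : AlphaWord a b) {i : ℕ} {l : List ℕ}
    (h : w.indices = i :: l) :
    ∃ (c : Obj) (hi : IsAlpha a i c) (w' : AlphaWord c b),
      w = w'.after (snoc (nil a) i hi) ∧ w'.indices = l := by
  obtain ⟨c, w₁, w₂, rfl, e₁, e₂⟩ := w.exists_after (l₁ := [i]) (l₂ := l) h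
  cases w₁ with
  | nil => simp [indices] at e₁
  | snoc v j hj =>
    obtain ⟨h₁, h₂⟩ := List.append_inj' (show v.indices ++ [j] = [] ++ [i] from e₁) rfl
    obtain rfl : j = i := by simpa using h₂
    cases v with
    | nil => exact ⟨c, hj, w₂, rfl, e₂⟩
    | snoc u k hk => simp [indices] at h₁

lemma indexList {a b : Obj} (w : AlphaWord a b) : IndexList a.rank w.indices := by
  have key : ∀ (l : List ℕ) {a b : Obj} (w : AlphaWord a b), w.indices = l →
      IndexList a.rank l := by
    intro l
    induction l with
    | nil => intros; trivial
    | cons i l ih =>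
      intro a b w h
      obtain ⟨c, hi, w', -, h'⟩ := w.exists_after_cons h
      refine ⟨hi.one_le, hi.le, ?_⟩
      rw [hi.rank_eq]
      exact ih w' h'
  exact key _ w rfl

/-- Two words of Type I represent the same morphism, and so do the words `w^*`. -/
def Equiv {a b : Obj} (w w' : AlphaWord a b) : Prop :=
  w.toWord.eval = w'.toWord.eval ∧ w.star.eval = w'.star.eval

lemma Equiv.after {a b c : Obj} {w w' : AlphaWord a b} {v v' : AlphaWord b c} (h : w.Equiv w')
    (h' : v.Equiv v') : (v.after w).Equiv (v'.after w') :=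
  ⟨by rw [toWord_after, toWord_after, h.1, h'.1], by rw [star_after, star_after, h.2, h'.2]⟩

lemma equiv_swap {a b b' c : Obj} {i j : ℕ} (hij : i + 1 < j) (hne : ¬ (i = 1 ∧ j = 2 * a.rank))
    (hj : IsAlpha a j b) (hi : IsAlpha b i c) (hi' : IsAlpha a i b') (hj' : IsAlpha b' (j - 2) c) :
    (snoc (snoc (nil a) j hj) i hi).Equiv (snoc (snoc (nil a) i hi') (j - 2) hj') := by
  have e₁ := (Rel.alpha_alpha i j hij (by simpa using hne) hj hi hi' hj').eval_eq
  obtain ⟨j, rfl⟩ := Nat.exists_eq_add_of_le' (show 2 ≤ j by omega)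
  have := hi.rank_eq
  have := hj.rank_eq
  have e₂ := (Rel.beta_beta i j (by omega) (by
    simp only [ne_eq, Prod.mk.injEq]; omega) hj' hi' hi hj).eval_eq
  rw [Word.eval_after, Word.eval_after] at e₁ e₂
  constructor
  · simp only [toWord, Word.eval_after, Word.eval_nil, Category.id_comp]
    exact e₁
  · simp only [star, Word.eval_after, Word.eval_nil, Category.comp_id]
    exact e₂.symm

/-- The only issue is the sign when the target is `[0±]`: the index into it is 1 or 2 according to
the sign, and excluding `(1, 2n)` makes `j - 2` agree with `i`. -/
lemma exists_isAlpha_forth {a b c : Obj} {i j : ℕ} (hij : i + 1 < j)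
    (hne : ¬ (i = 1 ∧ j = 2 * a.rank)) (hj : IsAlpha a j b) (hi : IsAlpha b i c) :
    ∃ b', IsAlpha a i b' ∧ IsAlpha b' (j - 2) c := by
  have := hi.one_le
  cases hj with
  | toPlus => omega
  | toMinus => omega
  | step n j h₁ h₂ =>
    refine ⟨.succ n, .step n i (by omega) (by omega), ?_⟩
    simp only [Obj.rank] at hne
    cases hi with
    | toPlus => rw [show j - 2 = 1 by omega]; exact .toPlus
    | toMinus => rw [show j - 2 = 2 by omega]; exact .toMinus
    | step n i h₃ h₄ => exact .step n _ (by omega) (by omega)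

lemma exists_isAlpha_back {a b' c : Obj} {i j : ℕ} (hij : i + 1 < j)
    (hne : ¬ (i = 1 ∧ j = 2 * a.rank)) (hjle : j ≤ 2 * a.rank) (hi' : IsAlpha a i b')
    (hj' : IsAlpha b' (j - 2) c) : ∃ b, IsAlpha a j b ∧ IsAlpha b i c := by
  have := hi'.one_le
  cases hi' with
  | toPlus => simp [Obj.rank] at hjle; omega
  | toMinus => simp [Obj.rank] at hjle; omega
  | step n i h₁ h₂ =>
    simp only [Obj.rank] at hne hjle
    refine ⟨.succ n, .step n j (by omega) (by omega), ?_⟩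
    generalize hk : j - 2 = k at hj'
    cases hj' with
    | toPlus => rw [show i = 1 by omega]; exact .toPlus
    | toMinus => rw [show i = 2 by omega]; exact .toMinus
    | step n k h₃ h₄ => exact .step n _ (by omega) (by omega)

end AlphaWord

/-- Lists do not record objects, so a word with the same endpoints must be rebuilt along each
rewriting step; both directions are carried because `IndexEq` is symmetric. -/
lemma IndexEq.exists_equiv {m : ℕ} {l l' : List ℕ} (h : IndexEq m l l') {a b : Obj}
    (ha : a.rank = m) :
    (∀ w : AlphaWord a b, w.indices = l → ∃ w' : AlphaWord a b, w'.indices = l' ∧ w.Equiv w') ∧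
      (∀ w : AlphaWord a b, w.indices = l' →
        ∃ w' : AlphaWord a b, w'.indices = l ∧ w.Equiv w') := by
  induction h generalizing a with
  | refl m l => exact ⟨fun w hw => ⟨w, hw, rfl, rfl⟩, fun w hw => ⟨w, hw, rfl, rfl⟩⟩
  | symm h ih => exact (ih ha).symm
  | trans h h' ih ih' =>
    constructor
    · intro w hw
      obtain ⟨w₁, h₁, e₁⟩ := (ih ha).1 w hw
      obtain ⟨w₂, h₂, e₂⟩ := (ih' ha).1 w₁ h₁
      exact ⟨w₂, h₂, e₁.1.trans e₂.1, e₁.2.trans e₂.2⟩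
    · intro w hw
      obtain ⟨w₁, h₁, e₁⟩ := (ih' ha).2 w hw
      obtain ⟨w₂, h₂, e₂⟩ := (ih ha).2 w₁ h₁
      exact ⟨w₂, h₂, e₁.1.trans e₂.1, e₁.2.trans e₂.2⟩
  | cons i h ih =>
    constructor
    · intro w hw
      obtain ⟨c, hi, v, rfl, hv⟩ := w.exists_after_cons hw
      have := hi.rank_eq
      obtain ⟨v', hv', e⟩ := (ih (a := c) (by omega)).1 v hv
      exact ⟨_, by rw [AlphaWord.indices_after, hv']; rfl, AlphaWord.Equiv.after ⟨rfl, rfl⟩ e⟩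
    · intro w hw
      obtain ⟨c, hi, v, rfl, hv⟩ := w.exists_after_cons hw
      have := hi.rank_eq
      obtain ⟨v', hv', e⟩ := (ih (a := c) (by omega)).2 v hv
      exact ⟨_, by rw [AlphaWord.indices_after, hv']; rfl, AlphaWord.Equiv.after ⟨rfl, rfl⟩ e⟩
  | swap i j l h1 hij hj hne =>
    subst ha
    constructor
    · intro w hw
      obtain ⟨c, hj, v, rfl, hv⟩ := w.exists_after_cons hw
      obtain ⟨c', hi, u, rfl, hu⟩ := v.exists_after_cons hv
      obtain ⟨b', hi', hj'⟩ := AlphaWord.exists_isAlpha_forth hij hne hj hi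
      have e := AlphaWord.equiv_swap hij hne hj hi hi' hj'
      refine ⟨u.after (.snoc (.snoc (.nil a) i hi') (j - 2) hj'), ?_, ?_⟩
      · rw [AlphaWord.indices_after, hu]; rfl
      · have := AlphaWord.Equiv.after e (v := u) (v' := u) ⟨rfl, rfl⟩
        refine ⟨?_, ?_⟩
        · rw [← this.1]
          simp only [AlphaWord.toWord_after, AlphaWord.toWord, Word.eval_after,
            Word.eval_nil, Category.id_comp, Category.assoc]
        · rw [← this.2]
          simp only [AlphaWord.star_after, AlphaWord.star, Word.eval_after,
            Word.eval_nil, Category.comp_id, Category.assoc]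
    · intro w hw
      obtain ⟨c, hi', v, rfl, hv⟩ := w.exists_after_cons hw
      obtain ⟨c', hj', u, rfl, hu⟩ := v.exists_after_cons hv
      obtain ⟨b', hj, hi⟩ := AlphaWord.exists_isAlpha_back hij hne hj hi' hj'
      have e := AlphaWord.equiv_swap hij hne hj hi hi' hj'
      refine ⟨u.after (.snoc (.snoc (.nil a) j hj) i hi), ?_, ?_⟩
      · rw [AlphaWord.indices_after, hu]; rfl
      · have := AlphaWord.Equiv.after e (v := u) (v' := u) ⟨rfl, rfl⟩
        refine ⟨?_, ?_⟩
        · rw [this.1]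
          simp only [AlphaWord.toWord_after, AlphaWord.toWord, Word.eval_after,
            Word.eval_nil, Category.id_comp, Category.assoc]
        · rw [this.2]
          simp only [AlphaWord.star_after, AlphaWord.star, Word.eval_after,
            Word.eval_nil, Category.comp_id, Category.assoc]

lemma StdList.exists_stdDecomp {m : ℕ} {l : List ℕ} (h : StdList m l) {a b : Obj}
    (ha : a.rank = m) (w : AlphaWord a b) (hw : w.indices = l) :
    ∃ d : StdDecomp a b, d.toAlphaWord = w := by
  induction h generalizing a with
  | @ord m l h =>
    subst ha
    cases w with
    | nil => exact ⟨.nil _, by rw [StdDecomp.toAlphaWord]⟩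
    | snoc v i hi =>
      have ho : (AlphaWord.snoc v i hi).IsOrdered := by
        refine ⟨by simp [AlphaWord.indices], ?_, ?_⟩
        · rw [hw]; exact h.pairwise
        · simp only [hw]; exact h.getElem_lt
      exact ⟨.single _ ho, by rw [StdDecomp.toAlphaWord]⟩
  | @wrap m n I J l h hl ih =>
    obtain ⟨c, w₁, w₂, rfl, e₁, e₂⟩ := w.exists_after hw
    obtain ⟨hI, hJ, hJ', hp, hm⟩ := h
    have hr := w₁.rank_eq
    rw [e₁] at hr
    simp only [List.length_append, List.length_singleton] at hr
    obtain ⟨d, rfl⟩ := ih (a := c) (by omega) w₂ e₂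
    have hw₁ : w₁.IsWrapped := by
      refine ⟨I, J, by rw [e₁, show c.rank = n by omega], hp, fun r hr => ?_, fun s hs => ?_⟩
      · have := hI.getElem_lt r hr
        omega
      · have := hJ.getElem_lt s hs
        have := hJ' _ (List.getElem_mem hs)
        omega
    exact ⟨.cons w₁ hw₁ d, by rw [StdDecomp.toAlphaWord]⟩

lemma AlphaWord.exists_stdDecomp {a b : Obj} (w : AlphaWord a b) :
    ∃ d : StdDecomp a b, w.Equiv d.toAlphaWord := by
  obtain ⟨l, he, hs⟩ := exists_stdList w.indexList
  obtain ⟨w', hw', e⟩ := (he.exists_equiv rfl).1 w rfl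
  obtain ⟨d, rfl⟩ := hs.exists_stdDecomp rfl w' hw'
  exact ⟨d, e⟩

lemma RotWord.exists_isReduced {a b : Obj} (w : RotWord a b) :
    ∃ w' : RotWord a b, w'.IsReduced ∧ w'.toWord.eval = w.toWord.eval := by
  cases w with
  | tauPow n s => exact ⟨.tauPow n (s % (n + 1)), Nat.mod_lt _ n.succ_pos, by
      simp only [toWord]; exact rotMor_mod n s⟩
  | idPlus => exact ⟨.idPlus, trivial, rfl⟩
  | idMinus => exact ⟨.idMinus, trivial, rfl⟩
  | sigmaPlus w => exact ⟨.sigmaPlus w, trivial, rfl⟩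
  | sigmaMinus w => exact ⟨.sigmaMinus w, trivial, rfl⟩

/-- The composite of morphisms underlying a standard form. -/
def StandardForm.toTypeDecomp {a b : Obj} (s : StandardForm a b) : TypeDecomp a b :=
  ⟨s.cPlus, s.cMinus, s.src, s.tgt, s.one.toAlphaWord.toWord.eval, s.two.toWord.eval,
    s.threeStar.toAlphaWord.star.eval, ⟨_, rfl⟩, ⟨_, rfl⟩, ⟨_, rfl⟩⟩

lemma StandardForm.eval_toTypeDecomp {a b : Obj} (s : StandardForm a b) :
    s.toTypeDecomp.eval = s.toWord.eval := by
  simp only [StandardForm.toWord, Word.eval_after, Category.assoc]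
  rfl

/-- The three words behind a composite can be replaced by standard or reduced ones without changing
the morphisms. Uniqueness for composites thus reduces to uniqueness for standard forms. -/
lemma StandardForm.toTypeDecomp_surjective {a b : Obj} (d : TypeDecomp a b) :
    ∃ s : StandardForm a b, s.toTypeDecomp = d := by
  obtain ⟨c, k, s, t, one, two, three, ⟨w₁, rfl⟩, ⟨w₂, rfl⟩, ⟨w₃, rfl⟩⟩ := d
  obtain ⟨d₁, h₁⟩ := w₁.exists_stdDecomp
  obtain ⟨d₃, h₃⟩ := w₃.exists_stdDecomp
  obtain ⟨w₂', hr, h₂⟩ := w₂.exists_isReduced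
  refine ⟨⟨c, k, s, t, d₁, w₂', hr, d₃⟩, ?_⟩
  simp only [StandardForm.toTypeDecomp, h₁.1, h₂, h₃.2]

/-! ### Uniqueness of the rotation -/

/-- Next to any index there is a neighbouring one on the same objects, and the zigzag relation
supplies the one-sided inverse. Target rank at least 1 is essential. -/
lemma exists_comp_capMor {n i : ℕ} {a : Obj} (h : IsAlpha a i (.succ n)) :
    (∃ g : ADelta.obj (.succ n) ⟶ ADelta.obj a, g ≫ capMor h = 𝟙 _) ∧
      ∃ g : ADelta.obj a ⟶ ADelta.obj (.succ n), cupMor h ≫ g = 𝟙 _ := by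
  cases h with
  | step n i h₁ h₂ =>
    have h : IsAlpha (.succ (n + 1)) i (.succ n) := .step n i h₁ h₂
    by_cases hi : i = 1
    · have h' : IsAlpha (.succ (n + 1)) (i + 1) (.succ n) := .step n _ (by omega) (by omega)
      refine ⟨⟨cupMor h', ?_⟩, ⟨capMor h', ?_⟩⟩
      · rw [← Word.eval_after, (Rel.alpha_beta_succ n i h' h).eval_eq, Word.eval_nil]
      · rw [← Word.eval_after, (Rel.alpha_succ_beta n i h h').eval_eq, Word.eval_nil]
    · obtain ⟨j, rfl⟩ := Nat.exists_eq_add_of_le' h₁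
      have h' : IsAlpha (.succ (n + 1)) j (.succ n) := .step n _ (by omega) (by omega)
      refine ⟨⟨cupMor h', ?_⟩, ⟨capMor h', ?_⟩⟩
      · rw [← Word.eval_after, (Rel.alpha_succ_beta n j h' h).eval_eq, Word.eval_nil]
      · rw [← Word.eval_after, (Rel.alpha_beta_succ n j h h').eval_eq, Word.eval_nil]

lemma AlphaWord.exists_comp {a b : Obj} (w : AlphaWord a b) {n : ℕ} (hb : b = .succ n) :
    (∃ g : ADelta.obj b ⟶ ADelta.obj a, g ≫ w.toWord.eval = 𝟙 _) ∧
      ∃ g : ADelta.obj a ⟶ ADelta.obj b, w.star.eval ≫ g = 𝟙 _ := by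
  induction w generalizing n with
  | nil =>
    simp only [toWord, star, Word.eval_nil, Category.comp_id, Category.id_comp]
    exact ⟨⟨_, rfl⟩, ⟨_, rfl⟩⟩
  | @snoc c b w i h ih =>
    subst hb
    obtain ⟨k, rfl⟩ : ∃ k, c = .succ k := by cases h; exact ⟨_, rfl⟩
    obtain ⟨⟨g, hg⟩, ⟨g', hg'⟩⟩ := ih rfl
    obtain ⟨⟨f, hf⟩, ⟨f', hf'⟩⟩ := exists_comp_capMor h
    refine ⟨⟨f ≫ g, ?_⟩, ⟨g' ≫ f', ?_⟩⟩
    · rw [eval_toWord_snoc, Category.assoc, ← Category.assoc g, hg, Category.id_comp, hf]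
    · rw [eval_star_snoc, Category.assoc, ← Category.assoc w.star.eval, hg', Category.id_comp, hf']

lemma rotate_eq_self {k e : ℕ} (he : e ≤ k)
    (h : (false :: List.replicate k true).rotate e = false :: List.replicate k true) : e = 0 := by
  by_contra h0
  have h1 : ((false :: List.replicate k true).rotate e)[0]? = some false := by rw [h]; rfl
  rw [List.getElem?_rotate (by simp), Nat.zero_add, Nat.mod_eq_of_lt (by simp; omega)] at h1
  obtain ⟨d, rfl⟩ := Nat.exists_eq_succ_of_ne_zero h0
  simp [List.getElem?_replicate] at h1

lemma rotMor_loopMor_injective {n s s' c d : ℕ} (hs : s < n + 1) (hs' : s' < n + 1)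
    (h : rotMor n s ≫ loopMor _ c d = rotMor n s' ≫ loopMor _ c d) : s = s' := by
  wlog hle : s ≤ s' generalizing s s'
  · exact (this hs' hs h.symm (by omega)).symm
  simp only [loopMor, ← Word.eval_after] at h
  -- A state with a single negative letter is moved by every nontrivial rotation; the loops act by a
  -- nonzero scalar and do no harm.
  set x₀ : List Bool := false :: List.replicate (2 * n + 1) true with hx₀
  have e := Word.op_eq_of_eval_eq h (Pi.single x₀ 1) (x := unrot (2 * s) x₀)
    (by rw [length_unrot, hx₀]; simp [Obj.rank]; ring)
  simp only [Word.op_after, LinearMap.comp_apply, Gen.op_pow, Gen.op, smul_pow,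
    LinearMap.smul_apply, ← Module.End.one_eq_id, one_pow, Module.End.one_apply, Pi.smul_apply,
    rotOp_pow_apply, unrot_rotate, smul_eq_mul, Pi.single_eq_same] at e
  have hr : (unrot (2 * s) x₀).rotate (2 * s') = x₀ := by
    by_contra hne
    rw [Pi.single_eq_of_ne hne] at e
    have : (0 : ℚ) < (15 / 2) ^ c * ((5 / 6) ^ d * 1) := by positivity
    simp only [mul_zero] at e
    exact this.ne' e
  rw [show 2 * s' = 2 * s + 2 * (s' - s) by omega, ← List.rotate_rotate, unrot_rotate] at hr
  have := rotate_eq_self (by omega) hr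
  omega

lemma RotWord.eq_of_loops {a b : Obj} (w w' : RotWord a b) (hb : b.rank = 0)
    (h : w.loops = w'.loops) : w = w' := by
  induction w with
  | tauPow n s => simp [Obj.rank] at hb
  | idPlus =>
    cases w' with
    | idPlus => rfl
    | sigmaMinus w' => simp [loops] at h
  | idMinus =>
    cases w' with
    | idMinus => rfl
    | sigmaPlus w' => simp [loops] at h
  | sigmaPlus w ih =>
    cases w' with
    | idMinus => simp [loops] at h
    | sigmaPlus w' => rw [ih w' rfl (by simpa [loops] using h)]
  | sigmaMinus w ih =>
    cases w' with
    | idPlus => simp [loops] at h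
    | sigmaMinus w' => rw [ih w' rfl (by simpa [loops] using h)]

/-- The extremal states fix the outer words and the scalar fixes the loops. In rank 0 the number of
letters `σ_±` fixes the middle word; in positive rank the outer words are cancelled and the rotation
is compared directly. -/
lemma StandardForm.eval_injective {a b : Obj} {s s' : StandardForm a b}
    (h : s.toWord.eval = s'.toWord.eval) : s = s' := by
  have h₁ := StdDecomp.ext_canon s.one s'.one (lower_eq h)
  have h₃ := StdDecomp.ext_canon s.threeStar s'.threeStar (upper_eq h)
  obtain ⟨c, k, p, q, one, two, hr, three⟩ := s
  obtain ⟨c', k', p', q', one', two', hr', three'⟩ := s'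
  cases h₁
  cases h₃
  obtain ⟨rfl, rfl, hl⟩ := loop_scalars_injective (scalar_eq h (fun _ => rfl) (fun _ => rfl))
  suffices two = two' by subst this; rfl
  by_cases hq : q.rank = 0
  · exact two.eq_of_loops two' hq hl
  · obtain ⟨n, rfl⟩ : ∃ n, q = .succ n := by
      cases q
      · exact absurd rfl hq
      · exact absurd rfl hq
      · exact ⟨_, rfl⟩
    cases two with
    | tauPow n r =>
      cases two' with
      | tauPow n r' =>
        obtain ⟨⟨g, hg⟩, -⟩ := one.toAlphaWord.exists_comp rfl
        obtain ⟨-, ⟨g', hg'⟩⟩ := three.toAlphaWord.exists_comp rfl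
        rw [← eval_toTypeDecomp, ← eval_toTypeDecomp] at h
        have key : ∀ x : ADelta.obj (.succ n) ⟶ ADelta.obj (.succ n),
            g ≫ (one.toAlphaWord.toWord.eval ≫ x ≫ three.toAlphaWord.star.eval ≫ loopMor b c k) ≫
              g' = x ≫ loopMor _ c k := by
          intro x
          simp only [Category.assoc, loopMor_comm]
          rw [← Category.assoc g, hg, Category.id_comp, ← Category.assoc three.toAlphaWord.star.eval,
            hg', Category.id_comp]
        have h' : rotMor n r ≫ loopMor _ c k = rotMor n r' ≫ loopMor _ c k := by
          rw [← key, ← key]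
          exact congrArg (fun f => g ≫ f ≫ g') h
        rw [rotMor_loopMor_injective hr hr' h']

end AnnularCat

theorem mainTheorem5 (m n : AnnularCat.Obj)
    (f : AnnularCat.ADelta.obj m ⟶ AnnularCat.ADelta.obj n) :
    (∃! s : AnnularCat.StandardForm m n, s.toWord.eval = f) ∧
      (∃! d : AnnularCat.TypeDecomp m n, d.eval = f) := by
  constructor
  · obtain ⟨d, rfl⟩ := AnnularCat.exists_typeDecomp f
    obtain ⟨s, rfl⟩ := AnnularCat.StandardForm.toTypeDecomp_surjective d
    exact ⟨s, s.eval_toTypeDecomp.symm, fun s' hs' =>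
      AnnularCat.StandardForm.eval_injective (hs'.trans s.eval_toTypeDecomp)⟩
  · obtain ⟨d, rfl⟩ := AnnularCat.exists_typeDecomp f
    refine ⟨d, rfl, fun d' hd' => ?_⟩
    obtain ⟨s, rfl⟩ := AnnularCat.StandardForm.toTypeDecomp_surjective d
    obtain ⟨s', rfl⟩ := AnnularCat.StandardForm.toTypeDecomp_surjective d'
    rw [AnnularCat.StandardForm.eval_injective
      (s'.eval_toTypeDecomp.symm.trans (hd'.trans s.eval_toTypeDecomp))]
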